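/- Let $\mathcal X$ be a measurable space with measurable sets $\mathcal B$, let $\mathcal U$ be a family of probability distributions on $\mathcal X$, and for $\epsilon>0$ let the $\epsilon$-fragmentation number $$N_{\mathcal U}(\epsilon)=\sup\Big\{k\in\mathbb N:\ \exists\text{ pairwise disjoint }A_1,\dots,A_k\in\mathcal B\ \text{ with }\ \sup_{\mu\in\mathcal U}\mu(A_i)\ge\epsilon\ \text{ for all } i\le k\Big\}\in\mathbb N\cup\{\infty\}.$$ Consider binary online classification over $T$ rounds. An oblivious $\mathcal U$-constrained adversary fixes in advance distributions $\mu_1,\dots,\mu_T\in\mathcal U$ and measurable labelling functions $g_1,\dots,g_T:\mathcal X\to\{0,1\}$. In round $t$, the (possibly randomized) algorithm chooses a measurable $f_t:\mathcal X\to\{0,1\}$ based on its private randomness and on $(x_s,y_s)_{s<t}$; then $x_t\sim\mu_t$ is drawn independently and $y_t=g_t(x_t)$ is revealed. The regret of an algorithm $\mathrm{alg}$ against a nonempty class $\mathcal F$ of measurable functions $\mathcal X\to\{0,1\}$ is $$\mathrm{Reg}_T(\mathrm{alg};\mathcal F,\mathcal U)=\mathbb E\Big[\sum_{t=1}^T\mathbf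 1\{f_t(x_t)\ne y_t\}-\inf_{f\in\mathcal F}\sum_{t=1}^T\mathbf 1\{f(x_t)\ne y_t\}\Big].$$ **Theorem.** There is an absolute constant $c>0$ such that the following holds for every measurable space $\mathcal X$, every family $\mathcal U$ of probability distributions on $\mathcal X$ and every integer $T\ge1$. For all $\epsilon>0$ and all integers $d\ge1$ with $3d\le N_{\mathcal U}(\epsilon)$, there is a nonempty class $\mathcal F$ of measurable functions $\mathcal X\to\{0,1\}$ of VC dimension at most $d$ such that for every algorithm $\mathrm{alg}$ there is an oblivious $\mathcal U$-constrained adversary against which the expectation defining the regret exists and $$\mathrm{Reg}_T(\mathrm{alg};\mathcal F,\mathcal U)\ \ge\ c\,\min\Big\{\sqrt{\epsilon\, d\, T\,\ln\frac{N_{\mathcal U}(\epsilon)}{d}},\ \epsilon T\Big\},$$ where the minimum is read as $\epsilon T$ if $N_{\mathcal U}(\epsilon)=\infty$. -/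

import Mathlib

open MeasureTheory
open scoped ENNReal

universe u v

/-- The VC dimension of a class `F` of `{0,1}`-valued functions: the supremum of all `n` for which
there are points `x₁, …, xₙ` on which the class realises all `2 ^ n` patterns. -/
noncomputable def vcDim {X : Type*} (F : Set (X → Bool)) : ℕ∞ :=
  ⨆ (n : ℕ) (_ : ∃ x : Fin n → X, ((fun (f : X → Bool) (i : Fin n) => f (x i)) '' F).ncard = 2 ^ n),
    (n : ℕ∞)

/-- The envelope functional `μ_U(A) = sup_{μ ∈ U} μ(A)` of a family `U` of distributions. -/
noncomputable def envelope {X : Type*} [MeasurableSpace X] (U : Set (ProbabilityMeasure X))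
    (A : Set X) : ℝ≥0∞ :=
  ⨆ μ ∈ U, (μ : Measure X) A

/-- The `ε`-fragmentation number `N_U(ε)`: the largest number of pairwise disjoint measurable sets
on each of which the envelope functional is at least `ε` (`⊤` if there is no largest number). -/
noncomputable def fragmentationNumber {X : Type*} [MeasurableSpace X]
    (U : Set (ProbabilityMeasure X)) (ε : ℝ) : ℕ∞ :=
  ⨆ (k : ℕ) (_ : ∃ A : Fin k → Set X, (∀ i, MeasurableSet (A i)) ∧
      (Pairwise fun i j => Disjoint (A i) (A j)) ∧ ∀ i, ENNReal.ofReal ε ≤ envelope U (A i)),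
    (k : ℕ∞)

/-- A (possibly randomized) online learning algorithm. It draws a private seed `ω` from an arbitrary
probability space. In the round with index `t` (counted from `0`), it chooses the classifier
`predict t ω h : X → {0,1}` from its seed and the `t` labelled examples `h` observed before. -/
structure OnlineAlgorithm (X : Type u) [MeasurableSpace X] where
  Seed : Type v
  [measurableSeed : MeasurableSpace Seed]
  seedLaw : Measure Seed
  [isProbabilityMeasure_seedLaw : IsProbabilityMeasure seedLaw]
  predict : (t : ℕ) → Seed → (Fin t → X × Bool) → X → Bool
  measurable_predict : ∀ t, Measurable fun p : Seed × (Fin t → X × Bool) × X =>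
    predict t p.1 p.2.1 p.2.2

attribute [instance] OnlineAlgorithm.measurableSeed OnlineAlgorithm.isProbabilityMeasure_seedLaw

/-- An oblivious `U`-constrained adversary for `T` rounds: before the first round it fixes
distributions `μ_t ∈ U` and measurable labelling rules. In round `t`, the instance `x_t` is
drawn from `μ_t`, independently of everything else, and gets the label `label t x_t`. -/
structure ObliviousAdversary {X : Type*} [MeasurableSpace X] (U : Set (ProbabilityMeasure X))
    (T : ℕ) where
  dist : Fin T → ProbabilityMeasure X
  dist_mem : ∀ t, dist t ∈ U
  label : Fin T → X → Bool
  measurable_label : ∀ t, Measurable (label t)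

/-- The indicator loss `𝟙{a ≠ b}`. -/
def zeroOneLoss (a b : Bool) : ℝ := if a ≠ b then 1 else 0

section Regret

variable {X : Type u} [MeasurableSpace X] {U : Set (ProbabilityMeasure X)} {T : ℕ}

/-- The labelled examples of the rounds before `t`, when the instances are `x`. -/
def history (adv : ObliviousAdversary U T) (x : Fin T → X) (t : Fin T) :
    Fin (t : ℕ) → X × Bool :=
  fun s => (x (s.castLE t.isLt.le), adv.label (s.castLE t.isLt.le) (x (s.castLE t.isLt.le)))

/-- The cumulative loss `∑ₜ 𝟙{f_t(x_t) ≠ y_t}` of the algorithm when its seed is `ω` and the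
instances are `x`. -/
def learnerLoss (alg : OnlineAlgorithm.{u, v} X) (adv : ObliviousAdversary U T)
    (ω : alg.Seed) (x : Fin T → X) : ℝ :=
  ∑ t : Fin T, zeroOneLoss (alg.predict t ω (history adv x t) (x t)) (adv.label t (x t))

/-- The cumulative loss `inf_{f ∈ F} ∑ₜ 𝟙{f(x_t) ≠ y_t}` of the best function of the class in
hindsight (used for nonempty `F`). -/
noncomputable def bestLoss (F : Set (X → Bool)) (adv : ObliviousAdversary U T)
    (x : Fin T → X) : ℝ :=
  ⨅ f : F, ∑ t : Fin T, zeroOneLoss (f.1 (x t)) (adv.label t (x t))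

/-- The realised regret, as a function of the seed of the algorithm and the instances. -/
noncomputable def realizedRegret (alg : OnlineAlgorithm.{u, v} X) (F : Set (X → Bool))
    (adv : ObliviousAdversary U T) (p : alg.Seed × (Fin T → X)) : ℝ :=
  learnerLoss alg adv p.1 p.2 - bestLoss F adv p.2

/-- The joint law of the seed of the algorithm and the instances `x_t ∼ μ_t`, all independent. -/
noncomputable def interactionLaw (alg : OnlineAlgorithm.{u, v} X) (adv : ObliviousAdversary U T) :
    Measure (alg.Seed × (Fin T → X)) :=
  alg.seedLaw.prod (Measure.pi fun t => (adv.dist t : Measure X))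

/-- The regret `Reg_T(alg; F, U)` after `T` rounds against the adversary `adv`: the expectation of
the realised regret. -/
noncomputable def regret (alg : OnlineAlgorithm.{u, v} X) (F : Set (X → Bool))
    (adv : ObliviousAdversary U T) : ℝ :=
  ∫ p, realizedRegret alg F adv p ∂(interactionLaw alg adv)

end Regret

/-- The rate `√(ε d T ln(N / d)) ∧ (ε T)`, which equals `ε T` when `N = ∞`. -/
noncomputable def lowerRate (ε : ℝ) (d T : ℕ) : ℕ∞ → ℝ
  | (N : ℕ) => min (Real.sqrt (ε * d * T * Real.log ((N : ℝ) / d))) (ε * T)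
  | ⊤ => ε * T

/-! Take `d` binary trees of depth `L` whose nodes are disjoint sets of envelope at least `ε`. A
string of `D = d * L` bits selects one branch per tree, and its function is the indicator of the
nodes where these branches turn right. If a branch turns right at a node, its turns above that node
are determined; hence a shattered set cannot have two points in nodes of the same tree, and the VC
dimension is at most `d` (`vcDim_branchFn_le`).

Split the `T` rounds into `D` phases of length about `n = T / D`. In phase `k` the adversary draws
from a law giving the current node mass `p ≥ ε / 2`; labels in the node are coins with bias `κ`
towards `σ k`, labels outside are fair. In expectation the learner loses `κ` more than the target
whenever it mispredicts `σ k` on the node, and nothing elsewhere. With `κ` of order `min 1 (1 / √(p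
n))`, the phase carries too little information to determine `σ k`: flipping this bit changes neither
the past phases nor the current node, and a second-moment change of measure makes the labels of the
phase fair (`prodAvg_bitWeight_ge`). The two targets together thus pay at least `κ p / 2` per round
(`integral_roundExcess_add_ge`).

Averaging over all targets and coins, some fixed choice gives regret of order `T * min ε √(ε / n)`,
that is `min √(ε D T) (ε T)` (`exists_regret_ge`). The trees fit when `d * L * 2 ^ L ≤ N`, so `L`
can be of order `ln (N / d)` (`exists_depth`). -/

section ProdAvg

/-! ### Averages under finite product weights -/

variable {ι β γ : Type*} [Fintype ι] [DecidableEq ι] [Fintype β] [Fintype γ]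

/-- The average of `G` under the product of the (signed) weights `m i` on `β`. -/
noncomputable def prodAvg (m : ι → β → ℝ) (G : (ι → β) → ℝ) : ℝ :=
  ∑ v, (∏ i, m i (v i)) * G v

theorem prodAvg_prod (m g : ι → β → ℝ) :
    prodAvg m (fun v => ∏ i, g i (v i)) = ∏ i, ∑ b, m i b * g i b := by
  unfold prodAvg
  rw [Finset.prod_univ_sum, Fintype.piFinset_univ]
  simp only [Finset.prod_mul_distrib]

theorem prodAvg_const {m : ι → β → ℝ} (hm : ∀ i, ∑ b, m i b = 1) (c : ℝ) :
    prodAvg m (fun _ => c) = c := by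
  have h := prodAvg_prod m (fun _ _ => 1)
  simp only [Finset.prod_const_one, mul_one, hm] at h
  unfold prodAvg at h ⊢
  rw [← Finset.sum_mul]
  simp only [mul_one] at h
  rw [h, one_mul]

theorem prodAvg_add (m : ι → β → ℝ) (G H : (ι → β) → ℝ) :
    prodAvg m (fun v => G v + H v) = prodAvg m G + prodAvg m H := by
  simp only [prodAvg, mul_add, Finset.sum_add_distrib]

theorem prodAvg_sub (m : ι → β → ℝ) (G H : (ι → β) → ℝ) :
    prodAvg m (fun v => G v - H v) = prodAvg m G - prodAvg m H := by
  simp only [prodAvg, mul_sub, Finset.sum_sub_distrib]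

theorem prodAvg_const_mul (m : ι → β → ℝ) (c : ℝ) (G : (ι → β) → ℝ) :
    prodAvg m (fun v => c * G v) = c * prodAvg m G := by
  simp only [prodAvg, Finset.mul_sum]
  exact Finset.sum_congr rfl fun v _ => by ring

theorem prodAvg_sum {κ : Type*} (s : Finset κ) (m : ι → β → ℝ) (G : κ → (ι → β) → ℝ) :
    prodAvg m (fun v => ∑ k ∈ s, G k v) = ∑ k ∈ s, prodAvg m (G k) := by
  simp only [prodAvg, Finset.mul_sum]
  exact Finset.sum_comm

theorem prodAvg_mono {m : ι → β → ℝ} (hm : ∀ i b, 0 ≤ m i b) {G H : (ι → β) → ℝ}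
    (h : ∀ v, G v ≤ H v) : prodAvg m G ≤ prodAvg m H :=
  Finset.sum_le_sum fun v _ =>
    mul_le_mul_of_nonneg_left (h v) (Finset.prod_nonneg fun i _ => hm i (v i))

/-- Coordinatewise maps push product weights to product weights. This turns an average over the
adversary's coins into one over the observed labels. -/
theorem prodAvg_map [DecidableEq β] (q : ι → γ → ℝ) (o : ι → γ → β) (G : (ι → β) → ℝ) :
    prodAvg q (fun u => G fun i => o i (u i)) =
      prodAvg (fun i b => ∑ a, if o i a = b then q i a else 0) G := by
  unfold prodAvg
  have h : ∀ v : ι → β, (∏ i, ∑ a, if o i a = v i then q i a else 0) =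
      ∑ u : ι → γ, if (fun i => o i (u i)) = v then ∏ i, q i (u i) else 0 := by
    intro v
    rw [Finset.prod_univ_sum, Fintype.piFinset_univ]
    refine Finset.sum_congr rfl fun u _ => ?_
    split_ifs with hu
    · exact Finset.prod_congr rfl fun i _ => if_pos (congrFun hu i)
    · obtain ⟨i, hi⟩ := Function.ne_iff.mp hu
      exact Finset.prod_eq_zero (Finset.mem_univ i) (if_neg hi)
  simp only [h, Finset.sum_mul]
  rw [Finset.sum_comm]
  refine Finset.sum_congr rfl fun u _ => ?_
  simp only [ite_mul, zero_mul]
  rw [Finset.sum_ite_eq]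
  simp

theorem prodAvg_split (p : ι → Prop) [DecidablePred p] (m : ι → β → ℝ) (G : (ι → β) → ℝ) :
    prodAvg m G = prodAvg (fun i : {i // p i} => m i) fun a =>
      prodAvg (fun i : {i // ¬ p i} => m i) fun b =>
        G ((Equiv.piEquivPiSubtypeProd p fun _ => β).symm (a, b)) := by
  unfold prodAvg
  rw [← (Equiv.piEquivPiSubtypeProd p fun _ => β).symm.sum_comp, Fintype.sum_prod_type]
  refine Finset.sum_congr rfl fun a _ => ?_
  rw [Finset.mul_sum]
  refine Finset.sum_congr rfl fun b _ => ?_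
  rw [← Fintype.prod_subtype_mul_prod_subtype p, mul_assoc]
  congr 1
  · exact Finset.prod_congr rfl fun i _ => by simp [Equiv.piEquivPiSubtypeProd, i.2]
  · congr 1
    exact Finset.prod_congr rfl fun i _ => by simp [Equiv.piEquivPiSubtypeProd, i.2]

/-- Weights of total mass one integrate out on the coordinates that `G` ignores, so they may be
altered there at will. -/
theorem prodAvg_congr_of_dependsOn [Nonempty β] (p : ι → Prop) {m m' : ι → β → ℝ}
    {G : (ι → β) → ℝ} (hm : ∀ i, ∑ b, m i b = 1) (hm' : ∀ i, ∑ b, m' i b = 1)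
    (h : ∀ i, p i → m i = m' i) (hG : ∀ v w, (∀ i, p i → v i = w i) → G v = G w) :
    prodAvg m G = prodAvg m' G := by
  classical
  obtain ⟨b₀⟩ := ‹Nonempty β›
  rw [prodAvg_split p, prodAvg_split p m']
  have h1 : (fun i : {i // p i} => m i) = fun i : {i // p i} => m' i :=
    funext fun i => h i i.2
  rw [h1]
  congr 1
  funext a
  have h2 : (fun b => G ((Equiv.piEquivPiSubtypeProd p fun _ => β).symm (a, b))) =
      fun _ => G ((Equiv.piEquivPiSubtypeProd p fun _ => β).symm (a, fun _ => b₀)) := by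
    funext b
    exact hG _ _ fun i hi => by simp [Equiv.piEquivPiSubtypeProd, hi]
  rw [h2, prodAvg_const (m := fun i : {i // ¬ p i} => m i) fun i => hm i,
    prodAvg_const (m := fun i : {i // ¬ p i} => m' i) fun i => hm' i]

theorem prodAvg_mul_coord {m : ι → β → ℝ} (hm : ∀ i, ∑ b, m i b = 1) (j : ι)
    {g : (ι → β) → ℝ} (hg : ∀ v w, (∀ i, i ≠ j → v i = w i) → g v = g w) (h : β → ℝ) :
    prodAvg m (fun v => g v * h (v j)) = prodAvg m g * ∑ b, m j b * h b := by
  rcases isEmpty_or_nonempty β with hβ | ⟨⟨b₀⟩⟩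
  · have := hm j
    simp at this
  rw [prodAvg_split (· ≠ j), prodAvg_split (· ≠ j) m g, mul_comm, ← prodAvg_const_mul]
  congr 1
  funext a
  have h2 : ∀ b, g ((Equiv.piEquivPiSubtypeProd (· ≠ j) fun _ => β).symm (a, b)) =
      g ((Equiv.piEquivPiSubtypeProd (· ≠ j) fun _ => β).symm (a, fun _ => b₀)) := fun b =>
    hg _ _ fun i hi => by simp [Equiv.piEquivPiSubtypeProd, hi]
  simp only [h2]
  rw [prodAvg_const (m := fun i : {i // ¬ i ≠ j} => m i) fun i => hm i, prodAvg_const_mul,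
    mul_comm]
  congr 1
  let j' : {i // ¬ i ≠ j} := ⟨j, by simp⟩
  have hj : ∀ i : {i // ¬ i ≠ j}, i = j' := fun i => Subtype.ext (not_not.mp i.2)
  have h3 : ∀ b : {i // ¬ i ≠ j} → β,
      h ((Equiv.piEquivPiSubtypeProd (· ≠ j) fun _ => β).symm (a, b) j) = ∏ i, h (b i) := by
    intro b
    rw [Fintype.prod_eq_single j' fun i hi => absurd (hj i) hi]
    simp [Equiv.piEquivPiSubtypeProd, j']
  simp only [h3]
  rw [prodAvg_prod, Fintype.prod_eq_single j' fun i hi => absurd (hj i) hi]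

end ProdAvg

/-! ### Biased bits and change of measure -/

/-- The sign `±1` of a bit. -/
def boolSign (b : Bool) : ℝ := if b then 1 else -1

/-- The weights on bits under which the mean of the sign is `l`. -/
noncomputable def bitWeight (l : ℝ) (b : Bool) : ℝ := (1 + l * boolSign b) / 2

theorem sum_bitWeight (l : ℝ) : ∑ b, bitWeight l b = 1 := by
  simp [bitWeight, boolSign]; ring

theorem bitWeight_nonneg {l : ℝ} (hl : |l| ≤ 1) (b : Bool) : 0 ≤ bitWeight l b := by
  have := abs_le.mp hl
  cases b <;> simp [bitWeight, boolSign] <;> linarith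

theorem zeroOneLoss_eq (a b : Bool) : zeroOneLoss a b = (1 - boolSign a * boolSign b) / 2 := by
  cases a <;> cases b <;> norm_num [zeroOneLoss, boolSign]

theorem zeroOneLoss_nonneg (a b : Bool) : 0 ≤ zeroOneLoss a b := by
  unfold zeroOneLoss; split_ifs <;> norm_num

theorem zeroOneLoss_le_one (a b : Bool) : zeroOneLoss a b ≤ 1 := by
  unfold zeroOneLoss; split_ifs <;> norm_num

theorem abs_boolSign (b : Bool) : |boolSign b| = 1 := by
  cases b <;> simp [boolSign]

theorem boolSign_sq (b : Bool) : boolSign b ^ 2 = 1 := by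
  cases b <;> simp [boolSign]

theorem zeroOneLoss_add_not (a b : Bool) : zeroOneLoss a b + zeroOneLoss a (!b) = 1 := by
  cases a <;> cases b <;> simp [zeroOneLoss]

/-- Changing the mean signs of some coordinates from `0` to `l i` changes the average of a
`[0,1]`-valued function by a controlled amount (a second-moment argument). -/
theorem prodAvg_bitWeight_ge {ι : Type*} [Fintype ι] [DecidableEq ι] {l₀ l : ι → ℝ}
    (hl₀ : ∀ i, |l₀ i| ≤ 1) (h0 : ∀ i, l₀ i = 0 ∨ l i = 0) {G : (ι → Bool) → ℝ}
    (hG0 : ∀ v, 0 ≤ G v) (hG1 : ∀ v, G v ≤ 1) :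
    3 / 4 * prodAvg (fun i => bitWeight (l₀ i)) G - (∏ i, (1 + l i ^ 2) - 1) ≤
      prodAvg (fun i => bitWeight (l₀ i + l i)) G := by
  set L : (ι → Bool) → ℝ := fun v => ∏ i, (1 + l i * boolSign (v i))
  -- The likelihood ratio is `1 + l i * boolSign b` exactly because no coordinate has both `l₀ i`
  -- and `l i` nonzero.
  have hw : ∀ i b, bitWeight (l₀ i + l i) b = bitWeight (l₀ i) b * (1 + l i * boolSign b) := by
    intro i b
    rcases h0 i with h | h <;> simp [bitWeight, h]
    ring
  have hchange : prodAvg (fun i => bitWeight (l₀ i + l i)) G =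
      prodAvg (fun i => bitWeight (l₀ i)) (fun v => L v * G v) := by
    simp only [prodAvg, hw, Finset.prod_mul_distrib, L, mul_assoc]
  have hL1 : prodAvg (fun i => bitWeight (l₀ i)) L = 1 := by
    simp only [L]
    rw [prodAvg_prod (fun i => bitWeight (l₀ i)) fun i b => 1 + l i * boolSign b]
    simp only [← hw, sum_bitWeight, Finset.prod_const_one]
  have hL2 : prodAvg (fun i => bitWeight (l₀ i)) (fun v => L v ^ 2) = ∏ i, (1 + l i ^ 2) := by
    simp only [L, ← Finset.prod_pow]
    rw [prodAvg_prod (fun i => bitWeight (l₀ i)) fun i b => (1 + l i * boolSign b) ^ 2]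
    refine Finset.prod_congr rfl fun i _ => ?_
    rcases h0 i with h | h <;> simp [bitWeight, boolSign, h] <;> ring
  have hsq : prodAvg (fun i => bitWeight (l₀ i)) (fun v => (L v - 1) ^ 2) =
      ∏ i, (1 + l i ^ 2) - 1 := by
    have : (fun v => (L v - 1) ^ 2) = fun v => (L v ^ 2 - 2 * L v) + 1 := by
      funext v; ring
    rw [this, prodAvg_add, prodAvg_sub, prodAvg_const_mul, hL1, hL2,
      prodAvg_const fun i => sum_bitWeight _]
    ring
  rw [hchange, ← hsq, ← prodAvg_const_mul, ← prodAvg_sub]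
  refine prodAvg_mono (fun i b => bitWeight_nonneg (hl₀ i) b) fun v => ?_
  have h1 := hG0 v
  have h2 := hG1 v
  -- The claim `3/4 * G - (L - 1)^2 ≤ L * G` is affine in `G`: at `G = 1` it reads `(L - 1/2)^2 ≥
  -- 0`, at `G = 0` it reads `(L - 1)^2 ≥ 0`.
  nlinarith [mul_nonneg h1 (sq_nonneg (L v - 1 + 1 / 2)),
    mul_nonneg (sub_nonneg.mpr h2) (sq_nonneg (L v - 1))]

/-- Marginalisation. It serves to compare two targets whose instance laws differ only in later
phases. -/
theorem integral_pi_congr_of_dependsOn {ι X : Type*} [Fintype ι] [MeasurableSpace X]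
    (p : ι → Prop) {μ ν : ι → Measure X} [∀ i, IsProbabilityMeasure (μ i)]
    [∀ i, IsProbabilityMeasure (ν i)] {f : (ι → X) → ℝ} (h : ∀ i, p i → μ i = ν i)
    (hf : ∀ x y, (∀ i, p i → x i = y i) → f x = f y) :
    ∫ x, f x ∂(Measure.pi μ) = ∫ x, f x ∂(Measure.pi ν) := by
  classical
  obtain ⟨x₀⟩ : Nonempty (ι → X) :=
    ⟨fun i => (nonempty_of_isProbabilityMeasure (μ i)).some⟩
  let e := MeasurableEquiv.piEquivPiSubtypeProd (fun _ : ι => X) p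
  have key : ∀ (ρ : ι → Measure X) [∀ i, IsProbabilityMeasure (ρ i)],
      ∫ x, f x ∂(Measure.pi ρ) =
        ∫ a, f (e.symm (a, (e x₀).2)) ∂(Measure.pi fun i : {i // p i} => ρ i) := by
    intro ρ _
    have h1 : ∀ x, f x = (fun z => f (e.symm (z.1, (e x₀).2))) (e x) := by
      intro x
      refine hf _ _ fun i hi => ?_
      change x i = (Equiv.piEquivPiSubtypeProd p fun _ => X).symm (_, _) i
      simp [Equiv.piEquivPiSubtypeProd, hi, e, MeasurableEquiv.piEquivPiSubtypeProd]
    rw [integral_congr_ae (Filter.Eventually.of_forall h1),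
      (measurePreserving_piEquivPiSubtypeProd ρ p).integral_comp'
        (g := fun z => f (e.symm (z.1, (e x₀).2))),
      integral_fun_fst (f := fun a => f (e.symm (a, (e x₀).2)))]
    simp
  rw [key μ, key ν]
  congr 2
  funext i
  exact h i i.2

/-! ### Label trees and the bias -/

/-- A family of functions `fn σ`, indexed by strings `σ` of `D` bits, with a set `node k σ` for
each `k` on which `fn σ` has the value `σ k`, such that this set, and a law attached to it, depend
only on the bits before `k`. -/
structure LabelTree {X : Type*} [MeasurableSpace X] (U : Set (ProbabilityMeasure X)) (D : ℕ) where
  law : Fin D → (Fin D → Bool) → ProbabilityMeasure X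
  law_mem : ∀ k σ, law k σ ∈ U
  node : Fin D → (Fin D → Bool) → Set X
  measurableSet_node : ∀ k σ, MeasurableSet (node k σ)
  fn : (Fin D → Bool) → X → Bool
  measurable_fn : ∀ σ, Measurable (fn σ)
  law_congr : ∀ k σ σ', (∀ j < k, σ j = σ' j) → law k σ = law k σ'
  node_congr : ∀ k σ σ', (∀ j < k, σ j = σ' j) → node k σ = node k σ'
  fn_of_mem : ∀ k σ, ∀ x ∈ node k σ, fn σ x = σ k

namespace LabelTree

variable {X : Type*} [MeasurableSpace X] {U : Set (ProbabilityMeasure X)} {D : ℕ}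
  (τ : LabelTree U D)

/-- The probability of a node under its law. -/
noncomputable def mass (k : Fin D) (σ : Fin D → Bool) : ℝ :=
  (τ.law k σ : Measure X).real (τ.node k σ)

/-- The bias of the labels at a node that is played for `n` rounds. -/
noncomputable def bias (n : ℕ) (k : Fin D) (σ : Fin D → Bool) : ℝ :=
  1 / (4 * max 1 (Real.sqrt (τ.mass k σ * n)))

/-- The conditional mean of the sign of the label, given the instances `x`, in the round `s`. -/
noncomputable def meanSign {T : ℕ} (ph : Fin T → Fin D) (n : ℕ) (σ : Fin D → Bool) (x : Fin T → X)
    (s : Fin T) : ℝ :=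
  (τ.node (ph s) σ).indicator (fun _ => τ.bias n (ph s) σ * boolSign (σ (ph s))) (x s)

theorem mass_nonneg (k : Fin D) (σ : Fin D → Bool) : 0 ≤ τ.mass k σ := measureReal_nonneg

theorem mass_congr {k : Fin D} {σ σ' : Fin D → Bool} (h : ∀ j < k, σ j = σ' j) :
    τ.mass k σ = τ.mass k σ' := by
  rw [mass, mass, τ.law_congr k σ σ' h, τ.node_congr k σ σ' h]

theorem bias_congr (n : ℕ) {k : Fin D} {σ σ' : Fin D → Bool} (h : ∀ j < k, σ j = σ' j) :
    τ.bias n k σ = τ.bias n k σ' := by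
  rw [bias, bias, τ.mass_congr h]

theorem bias_pos (n : ℕ) (k : Fin D) (σ : Fin D → Bool) : 0 < τ.bias n k σ := by
  have : (1 : ℝ) ≤ max 1 (Real.sqrt (τ.mass k σ * n)) := le_max_left _ _
  unfold bias
  positivity

theorem bias_lt_one (n : ℕ) (k : Fin D) (σ : Fin D → Bool) : τ.bias n k σ < 1 := by
  have : (1 : ℝ) ≤ max 1 (Real.sqrt (τ.mass k σ * n)) := le_max_left _ _
  unfold bias
  rw [div_lt_one (by positivity)]
  linarith

theorem bias_le_one (n : ℕ) (k : Fin D) (σ : Fin D → Bool) : τ.bias n k σ ≤ 1 :=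
  (τ.bias_lt_one n k σ).le

/-- About `n p` instances of a phase hit the node, each adding `κ ^ 2` to the evidence on the bit.
The bias is chosen so that the total stays below a small constant. -/
theorem bias_sq_mul_mass_le (n : ℕ) (k : Fin D) (σ : Fin D → Bool) :
    n * (τ.bias n k σ ^ 2 * τ.mass k σ) ≤ 1 / 16 := by
  have h1 : (1 : ℝ) ≤ max 1 (Real.sqrt (τ.mass k σ * n)) := le_max_left _ _
  have h2 : Real.sqrt (τ.mass k σ * n) ≤ max 1 (Real.sqrt (τ.mass k σ * n)) := le_max_right _ _
  have h0 : 0 ≤ τ.mass k σ * n := mul_nonneg (τ.mass_nonneg k σ) n.cast_nonneg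
  have h3 : τ.mass k σ * n ≤ max 1 (Real.sqrt (τ.mass k σ * n)) ^ 2 := by
    calc τ.mass k σ * n = Real.sqrt (τ.mass k σ * n) ^ 2 := (Real.sq_sqrt h0).symm
      _ ≤ _ := pow_le_pow_left₀ (Real.sqrt_nonneg _) h2 2
  unfold bias
  set M := max 1 (Real.sqrt (τ.mass k σ * n))
  have hM : (0 : ℝ) < M := by linarith
  have : n * ((1 / (4 * M)) ^ 2 * τ.mass k σ) = τ.mass k σ * n / (16 * M ^ 2) := by
    field_simp; ring
  rw [this, div_le_div_iff₀ (by positivity) (by norm_num)]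
  linarith

/-- Bias times mass is `min p √(p / n) / 4`, which increases with `p`. -/
theorem bias_mul_mass_ge {n : ℕ} (hn : 1 ≤ n) {r : ℝ} (hr : 0 ≤ r) (k : Fin D)
    (σ : Fin D → Bool) (h : r ≤ τ.mass k σ) :
    min r (Real.sqrt (r / n)) / 4 ≤ τ.bias n k σ * τ.mass k σ := by
  have hn' : (0 : ℝ) < n := by exact_mod_cast hn
  have h0 := hr.trans h
  unfold bias
  set p := τ.mass k σ
  rcases le_total 1 (Real.sqrt (p * n)) with h1 | h1
  · rw [max_eq_right h1]
    have h2 : Real.sqrt (p / n) = 1 / Real.sqrt (p * n) * p := by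
      have hs : 0 < Real.sqrt (p * n) := by linarith
      rw [one_div, inv_mul_eq_div, eq_div_iff hs.ne', ← Real.sqrt_mul (by positivity)]
      rw [show p / n * (p * n) = p ^ 2 by field_simp, Real.sqrt_sq h0]
    have h3 : Real.sqrt (r / n) ≤ Real.sqrt (p / n) := by gcongr
    have : 1 / (4 * Real.sqrt (p * n)) * p = (1 / Real.sqrt (p * n) * p) / 4 := by
      field_simp
    rw [this, ← h2]
    have := min_le_right r (Real.sqrt (r / n))
    linarith
  · rw [max_eq_left h1]
    have := min_le_left r (Real.sqrt (r / n))
    linarith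

/-! ### Excess loss in a single round -/

variable {T : ℕ} (ph : Fin T → Fin D) (n : ℕ)

theorem abs_meanSign_le (σ : Fin D → Bool) (x : Fin T → X) (s : Fin T) :
    |τ.meanSign ph n σ x s| ≤ 1 := by
  unfold meanSign
  by_cases h : x s ∈ τ.node (ph s) σ
  · rw [Set.indicator_of_mem h, abs_mul, abs_boolSign, mul_one, abs_of_pos (τ.bias_pos n _ σ)]
    exact τ.bias_le_one n _ σ
  · rw [Set.indicator_of_notMem h]; simp

theorem measurable_meanSign (σ : Fin D → Bool) (s : Fin T) :
    Measurable fun x : Fin T → X => τ.meanSign ph n σ x s :=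
  (measurable_const.indicator (τ.measurableSet_node _ _)).comp (measurable_pi_apply s)

/-- The expected excess loss in round `t` over the target `fn σ`, where `a x v` is the prediction
for the instances `x` and the observed labels `v`. -/
noncomputable def roundExcess (t : Fin T) (a : (Fin T → X) → (Fin T → Bool) → Bool)
    (σ : Fin D → Bool) (x : Fin T → X) : ℝ :=
  (τ.node (ph t) σ).indicator (fun _ => τ.bias n (ph t) σ) (x t) *
    prodAvg (fun s => bitWeight (τ.meanSign ph n σ x s)) fun v => zeroOneLoss (a x v) (σ (ph t))

/-- The product of the second moments of the likelihood ratios of the labels observed before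
round `t` in the phase of round `t`. -/
noncomputable def secondMoment (t : Fin T) (σ : Fin D → Bool) (x : Fin T → X) : ℝ :=
  ∏ s, (1 + if s < t ∧ ph s = ph t then
    (τ.node (ph t) σ).indicator (fun _ => τ.bias n (ph t) σ ^ 2) (x s) else 0)

/-- The lower bound for the excess loss in round `t`, divided by the bias, after a change of measure
to fair labels in the phase of round `t`; here `b` stands for the bit tested in this phase. -/
noncomputable def roundBound (t : Fin T) (a : (Fin T → X) → (Fin T → Bool) → Bool)
    (b : Bool) (σ : Fin D → Bool) (x : Fin T → X) : ℝ :=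
  (τ.node (ph t) σ).indicator (fun _ => 1) (x t) *
    (3 / 4 * prodAvg (fun s => bitWeight (if ph s < ph t then τ.meanSign ph n σ x s else 0))
      (fun v => zeroOneLoss (a x v) b) - (τ.secondMoment ph n t σ x - 1))

variable {ph} (hph : Monotone ph) {t : Fin T} {a : (Fin T → X) → (Fin T → Bool) → Bool}
  (ha : ∀ x x' v v', (∀ s ≤ t, x s = x' s) → (∀ s < t, v s = v' s) → a x v = a x' v')

include hph ha in
-- Labels from round `t` on integrate out, those of earlier phases keep their means `l₀`, and those
-- observed in the current phase have means `l`, which the change of measure replaces by zero.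
theorem roundBound_le_roundExcess (σ : Fin D → Bool) (x : Fin T → X) :
    τ.bias n (ph t) σ * τ.roundBound ph n t a (σ (ph t)) σ x ≤ τ.roundExcess ph n t a σ x := by
  unfold roundBound roundExcess
  by_cases hx : x t ∈ τ.node (ph t) σ
  swap
  · simp [Set.indicator_of_notMem hx]
  simp only [Set.indicator_of_mem hx, one_mul]
  refine mul_le_mul_of_nonneg_left ?_ (τ.bias_pos n _ σ).le
  set l₀ : Fin T → ℝ := fun s => if ph s < ph t then τ.meanSign ph n σ x s else 0
  set l : Fin T → ℝ := fun s => if s < t ∧ ph s = ph t then τ.meanSign ph n σ x s else 0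
  have h1 : prodAvg (fun s => bitWeight (τ.meanSign ph n σ x s))
      (fun v => zeroOneLoss (a x v) (σ (ph t))) =
      prodAvg (fun s => bitWeight (l₀ s + l s)) fun v => zeroOneLoss (a x v) (σ (ph t)) := by
    refine prodAvg_congr_of_dependsOn (· < t) (fun s => sum_bitWeight _)
      (fun s => sum_bitWeight _) (fun s hs => ?_) fun v w hvw => ?_
    · rcases (hph hs.le).lt_or_eq with h | h
      · simp [l₀, l, h, h.ne]
      · simp [l₀, l, h, hs]
    · rw [ha x x v w (fun _ _ => rfl) hvw]
  have h2 : τ.secondMoment ph n t σ x = ∏ s, (1 + l s ^ 2) := by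
    refine Finset.prod_congr rfl fun s _ => ?_
    by_cases h : s < t ∧ ph s = ph t
    · by_cases hs : x s ∈ τ.node (ph t) σ <;>
        simp [l, h, meanSign, hs, mul_pow, boolSign_sq]
    · simp [l, h]
  rw [h1, h2]
  refine prodAvg_bitWeight_ge (fun s => ?_) (fun s => ?_) (fun v => zeroOneLoss_nonneg _ _)
    fun v => zeroOneLoss_le_one _ _
  · by_cases h : ph s < ph t
    · simpa [l₀, h] using τ.abs_meanSign_le ph n σ x s
    · simp [h]
  · by_cases h : ph s < ph t
    · right; simp [l, h.ne]
    · left; simp [h]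

/-- After the change of measure, the bit of the current phase enters only through `b`. Two targets
differing in this bit therefore share the remaining expression. -/
theorem roundBound_congr (b : Bool) {σ σ' : Fin D → Bool} (h : ∀ j < ph t, σ j = σ' j)
    (x : Fin T → X) : τ.roundBound ph n t a b σ x = τ.roundBound ph n t a b σ' x := by
  unfold roundBound secondMoment
  rw [τ.node_congr _ σ σ' h, τ.bias_congr n h]
  have : ∀ s, (if ph s < ph t then τ.meanSign ph n σ x s else 0) =
      if ph s < ph t then τ.meanSign ph n σ' x s else 0 := by
    intro s
    split_ifs with hs
    · have h' : ∀ j < ph s, σ j = σ' j := fun j hj => h j (hj.trans hs)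
      rw [meanSign, meanSign, τ.node_congr _ σ σ' h', τ.bias_congr n h', h _ hs]
    · rfl
  simp only [this]

include hph ha in
theorem roundBound_dependsOn (b : Bool) (σ : Fin D → Bool) (x y : Fin T → X)
    (h : ∀ s ≤ t, x s = y s) : τ.roundBound ph n t a b σ x = τ.roundBound ph n t a b σ y := by
  have h1 : τ.secondMoment ph n t σ x = τ.secondMoment ph n t σ y := by
    refine Finset.prod_congr rfl fun s _ => ?_
    split_ifs with hs
    · rw [h s hs.1.le]
    · rfl
  have h2 : ∀ s, (if ph s < ph t then τ.meanSign ph n σ x s else 0) =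
      if ph s < ph t then τ.meanSign ph n σ y s else 0 := by
    intro s
    split_ifs with hs
    · rw [meanSign, meanSign, h s (le_of_not_gt fun hlt => (hph hlt.le).not_gt hs)]
    · rfl
  have h3 : ∀ v, a x v = a y v := fun v => ha x y v v h fun _ _ => rfl
  unfold roundBound
  simp only [h1, h2, h3, h t le_rfl]

theorem measurable_secondMoment (t : Fin T) (σ : Fin D → Bool) :
    Measurable (τ.secondMoment ph n t σ : (Fin T → X) → ℝ) := by
  refine Finset.measurable_fun_prod _ fun s _ => ?_
  by_cases hs : s < t ∧ ph s = ph t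
  · simp only [hs, and_self, if_true]
    exact measurable_const.add
      ((measurable_const.indicator (τ.measurableSet_node _ _)).comp (measurable_pi_apply s))
  · simp only [hs, if_false]
    exact measurable_const

theorem secondMoment_nonneg (t : Fin T) (σ : Fin D → Bool) (x : Fin T → X) :
    0 ≤ τ.secondMoment ph n t σ x := by
  refine Finset.prod_nonneg fun s _ => ?_
  have : 0 ≤ (τ.node (ph t) σ).indicator (fun _ => τ.bias n (ph t) σ ^ 2) (x s) :=
    Set.indicator_nonneg (fun _ _ => by positivity) _
  split_ifs <;> linarith

/-- A crude bound, needed for integrability only. -/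
theorem secondMoment_le (t : Fin T) (σ : Fin D → Bool) (x : Fin T → X) :
    τ.secondMoment ph n t σ x ≤ 2 ^ T := by
  have hb : τ.bias n (ph t) σ ^ 2 ≤ 1 := pow_le_one₀ (τ.bias_pos n _ σ).le (τ.bias_le_one n _ σ)
  have h : ∀ s, 0 ≤ (τ.node (ph t) σ).indicator (fun _ => τ.bias n (ph t) σ ^ 2) (x s) ∧
      (τ.node (ph t) σ).indicator (fun _ => τ.bias n (ph t) σ ^ 2) (x s) ≤ 1 := fun s =>
    ⟨Set.indicator_nonneg (fun _ _ => by positivity) _,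
      Set.indicator_apply_le' (fun _ => hb) fun _ => zero_le_one⟩
  calc τ.secondMoment ph n t σ x ≤ ∏ _s : Fin T, (2 : ℝ) := by
        refine Finset.prod_le_prod (fun s _ => ?_) fun s _ => ?_ <;> have := h s <;>
          split_ifs <;> linarith
    _ = 2 ^ T := by simp

theorem measurable_zeroOneLoss {Y : Type*} [MeasurableSpace Y] {f g : Y → Bool} (hf : Measurable f)
    (hg : Measurable g) : Measurable fun y => zeroOneLoss (f y) (g y) :=
  (measurable_from_prod_countable_left fun _ => measurable_of_finite _ :
    Measurable fun z : Bool × Bool => zeroOneLoss z.1 z.2).comp (hf.prodMk hg)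

theorem measurable_prodAvg_bitWeight {Y : Type*} [MeasurableSpace Y] {l : Fin T → Y → ℝ}
    (hl : ∀ s, Measurable (l s)) {G : Y → (Fin T → Bool) → ℝ}
    (hG : ∀ v, Measurable fun x => G x v) :
    Measurable fun x => prodAvg (fun s => bitWeight (l s x)) (G x) := by
  unfold prodAvg bitWeight
  refine Finset.measurable_fun_sum _ fun v _ => Measurable.mul ?_ (hG v)
  refine Finset.measurable_fun_prod _ fun s _ => ?_
  exact ((hl s).mul_const _ |>.const_add 1).div_const 2

theorem prodAvg_mem_Icc {l : Fin T → ℝ} (hl : ∀ s, |l s| ≤ 1) {G : (Fin T → Bool) → ℝ}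
    (h0 : ∀ v, 0 ≤ G v) (h1 : ∀ v, G v ≤ 1) :
    0 ≤ prodAvg (fun s => bitWeight (l s)) G ∧ prodAvg (fun s => bitWeight (l s)) G ≤ 1 := by
  have hw : ∀ s b, 0 ≤ bitWeight (l s) b := fun s b => bitWeight_nonneg (hl s) b
  constructor
  · calc 0 = prodAvg (fun s => bitWeight (l s)) fun _ => 0 := by simp [prodAvg]
      _ ≤ _ := prodAvg_mono hw h0
  · calc _ ≤ prodAvg (fun s => bitWeight (l s)) fun _ => 1 := prodAvg_mono hw h1
      _ = 1 := prodAvg_const (fun s => sum_bitWeight _) 1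

theorem integrable_roundBound (hm : ∀ v, Measurable fun x => a x v) (b : Bool) (σ : Fin D → Bool)
    (P : Measure (Fin T → X)) [IsFiniteMeasure P] :
    Integrable (τ.roundBound ph n t a b σ) P := by
  refine Integrable.of_bound (C := 1 + (2 ^ T + 1)) (Measurable.aestronglyMeasurable ?_)
    (Filter.Eventually.of_forall fun x => ?_)
  · unfold roundBound
    refine Measurable.mul
      ((measurable_const.indicator (τ.measurableSet_node _ _)).comp (measurable_pi_apply t))
      (Measurable.sub (Measurable.const_mul (measurable_prodAvg_bitWeight (fun s => ?_)
        fun v => measurable_zeroOneLoss (hm v) measurable_const) _)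
        ((τ.measurable_secondMoment n t σ).sub_const 1))
    split_ifs
    · exact τ.measurable_meanSign ph n σ s
    · exact measurable_const
  · have h1 := prodAvg_mem_Icc (l := fun s => if ph s < ph t then τ.meanSign ph n σ x s else 0)
      (fun s => by split_ifs <;> simp [τ.abs_meanSign_le ph n σ x s])
      (G := fun v => zeroOneLoss (a x v) b) (fun v => zeroOneLoss_nonneg _ _)
      fun v => zeroOneLoss_le_one _ _
    have h2 := τ.secondMoment_nonneg (ph := ph) n t σ x
    have h3 := τ.secondMoment_le (ph := ph) n t σ x
    have h4 : (0 : ℝ) < 2 ^ T := by positivity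
    unfold roundBound
    by_cases hx : x t ∈ τ.node (ph t) σ
    · rw [Set.indicator_of_mem hx, one_mul, Real.norm_eq_abs, abs_le]
      constructor <;> linarith
    · rw [Set.indicator_of_notMem hx, zero_mul, norm_zero]
      positivity

theorem integrable_roundExcess {Y : Type*} [MeasurableSpace Y] {ξ : Y → Fin T → X}
    (hξ : Measurable ξ) {a : Y → (Fin T → X) → (Fin T → Bool) → Bool}
    (hm : ∀ v, Measurable fun y => a y (ξ y) v) (σ : Fin D → Bool)
    (P : Measure Y) [IsFiniteMeasure P] :
    Integrable (fun y => τ.roundExcess ph n t (a y) σ (ξ y)) P := by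
  refine Integrable.of_bound (C := 1) (Measurable.aestronglyMeasurable ?_)
    (Filter.Eventually.of_forall fun y => ?_)
  · unfold roundExcess
    exact Measurable.mul
      ((measurable_const.indicator (τ.measurableSet_node _ _)).comp
        ((measurable_pi_apply t).comp hξ))
      (measurable_prodAvg_bitWeight (fun s => (τ.measurable_meanSign ph n σ s).comp hξ)
        fun v => measurable_zeroOneLoss (hm v) measurable_const)
  · have h1 := prodAvg_mem_Icc (τ.abs_meanSign_le ph n σ (ξ y))
      (G := fun v => zeroOneLoss (a y (ξ y) v) (σ (ph t))) (fun v => zeroOneLoss_nonneg _ _)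
      fun v => zeroOneLoss_le_one _ _
    unfold roundExcess
    by_cases hx : ξ y t ∈ τ.node (ph t) σ
    · rw [Set.indicator_of_mem hx, Real.norm_eq_abs,
        abs_of_nonneg (mul_nonneg (τ.bias_pos n _ σ).le h1.1)]
      exact mul_le_one₀ (τ.bias_le_one n _ σ) h1.1 h1.2
    · simp [Set.indicator_of_notMem hx]

/-- The law of the instances when the target is `fn σ`. -/
noncomputable def instanceLaw (ph : Fin T → Fin D) (σ : Fin D → Bool) : Measure (Fin T → X) :=
  Measure.pi fun s => (τ.law (ph s) σ : Measure X)

instance (ph : Fin T → Fin D) (σ : Fin D → Bool) :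
    IsProbabilityMeasure (τ.instanceLaw ph σ) := by
  unfold instanceLaw; infer_instance

/-- The integrand is a product over independent rounds: round `t` contributes `p`, and each of the
at most `n` earlier rounds of the phase contributes `1 + κ ^ 2 * p`. The choice of the bias bounds
the product of the latter by `exp (1 / 16)`. -/
theorem integral_indicator_mul_secondMoment_le (t : Fin T) (σ : Fin D → Bool)
    (hn : (Finset.univ.filter fun s => s < t ∧ ph s = ph t).card ≤ n) :
    ∫ x, (τ.node (ph t) σ).indicator (fun _ => (1 : ℝ)) (x t) * τ.secondMoment ph n t σ x
      ∂(τ.instanceLaw ph σ) ≤ 9 / 8 * τ.mass (ph t) σ := by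
  set p := τ.mass (ph t) σ with hp
  set κ := τ.bias n (ph t) σ with hκ
  have hp0 : 0 ≤ p := τ.mass_nonneg _ _
  let φ : Fin T → X → ℝ := fun s y => (if t = s then
    (τ.node (ph t) σ).indicator (fun _ => (1 : ℝ)) y else 1) * (1 + if s < t ∧ ph s = ph t then
    (τ.node (ph t) σ).indicator (fun _ => κ ^ 2) y else 0)
  have h1 : ∀ x : Fin T → X, (τ.node (ph t) σ).indicator (fun _ => (1 : ℝ)) (x t) *
      τ.secondMoment ph n t σ x = ∏ s, φ s (x s) := by
    intro x
    simp only [φ]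
    rw [Finset.prod_mul_distrib, Finset.prod_ite_eq]
    simp [secondMoment, hκ]
  have h2 : ∀ s, ∫ y, φ s y ∂(τ.law (ph s) σ : Measure X) =
      (if t = s then p else 1) * (if s < t ∧ ph s = ph t then 1 + κ ^ 2 * p else 1) := by
    intro s
    by_cases hs : t = s
    · subst hs
      simp [φ, integral_indicator_const, τ.measurableSet_node, hp, mass]
    · by_cases hs' : s < t ∧ ph s = ph t
      · simp only [φ, hs, hs', if_false, and_self, if_true, one_mul]
        rw [integral_add (integrable_const _)
          ((integrable_const _).indicator (τ.measurableSet_node _ _)),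
          integral_indicator_const _ (τ.measurableSet_node _ _)]
        simp [hp, mass, mul_comm]
      · simp [φ, hs, hs']
  have h3 : ∏ s, ∫ y, φ s y ∂(τ.law (ph s) σ : Measure X) =
      p * (1 + κ ^ 2 * p) ^ (Finset.univ.filter fun s => s < t ∧ ph s = ph t).card := by
    simp only [h2]
    rw [Finset.prod_mul_distrib, Finset.prod_ite_eq, Finset.prod_ite]
    simp
  rw [integral_congr_ae (Filter.Eventually.of_forall h1), instanceLaw,
    integral_fintype_prod_eq_prod, h3, mul_comm]
  refine mul_le_mul_of_nonneg_right ?_ hp0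
  have h4 : 0 ≤ κ ^ 2 * p := by positivity
  calc (1 + κ ^ 2 * p) ^ (Finset.univ.filter fun s => s < t ∧ ph s = ph t).card
      ≤ (1 + κ ^ 2 * p) ^ n := pow_le_pow_right₀ (by linarith) hn
    _ ≤ Real.exp (κ ^ 2 * p) ^ n := by
        refine pow_le_pow_left₀ (by linarith) ?_ n
        have := Real.add_one_le_exp (κ ^ 2 * p)
        linarith
    _ = Real.exp (n * (κ ^ 2 * p)) := (Real.exp_nat_mul _ n).symm
    _ ≤ Real.exp (1 / 16) := Real.exp_le_exp.mpr (τ.bias_sq_mul_mass_le n _ σ)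
    _ ≤ 1 / (1 - 1 / 16) := Real.exp_bound_div_one_sub_of_interval (by norm_num) (by norm_num)
    _ ≤ 9 / 8 := by norm_num

include hph ha in
/-- The excess losses in round `t` for two targets that differ in the bit of the phase of `t`. -/
theorem integral_roundExcess_add_ge (hm : ∀ v, Measurable fun x => a x v) (σ : Fin D → Bool)
    (hn : (Finset.univ.filter fun s => s < t ∧ ph s = ph t).card ≤ n) :
    τ.bias n (ph t) σ * τ.mass (ph t) σ / 2 ≤
      ∫ x, τ.roundExcess ph n t a σ x ∂(τ.instanceLaw ph σ) +
        ∫ x, τ.roundExcess ph n t a (Function.update σ (ph t) (!σ (ph t))) x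
          ∂(τ.instanceLaw ph (Function.update σ (ph t) (!σ (ph t)))) := by
  set σ' := Function.update σ (ph t) (!σ (ph t)) with hσ'
  have hagree : ∀ j < ph t, σ' j = σ j := fun j hj => Function.update_of_ne hj.ne _ _
  have hbit : σ' (ph t) = !σ (ph t) := Function.update_self _ _ _
  have low : ∀ ρ : Fin D → Bool,
      τ.bias n (ph t) ρ * ∫ x, τ.roundBound ph n t a (ρ (ph t)) ρ x ∂(τ.instanceLaw ph ρ) ≤
        ∫ x, τ.roundExcess ph n t a ρ x ∂(τ.instanceLaw ph ρ) := by
    intro ρ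
    rw [← integral_const_mul]
    exact integral_mono ((τ.integrable_roundBound n hm _ _ _).const_mul _)
      (τ.integrable_roundExcess n measurable_id hm _ _) fun x =>
        τ.roundBound_le_roundExcess n hph ha ρ x
  have low1 := low σ
  have low2 := low σ'
  -- The laws for `σ` and `σ'` agree in all rounds up to `t`, even inside the phase of `t`, since
  -- the law of a phase depends only on strictly earlier bits.
  have hmarg : ∫ x, τ.roundBound ph n t a (σ' (ph t)) σ' x ∂(τ.instanceLaw ph σ') =
      ∫ x, τ.roundBound ph n t a (!σ (ph t)) σ x ∂(τ.instanceLaw ph σ) := by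
    rw [hbit]
    simp only [τ.roundBound_congr n (!σ (ph t)) hagree]
    refine integral_pi_congr_of_dependsOn (· ≤ t) (fun s hs => ?_)
      fun x y h => τ.roundBound_dependsOn n hph ha _ σ x y h
    rw [τ.law_congr _ σ' σ fun j hj => hagree j (hj.trans_le (hph hs))]
  rw [hmarg, τ.bias_congr n hagree] at low2
  set I : (Fin T → X) → ℝ := fun x => (τ.node (ph t) σ).indicator (fun _ => (1 : ℝ)) (x t)
  have hImeas : Measurable I :=
    (measurable_const.indicator (τ.measurableSet_node _ _)).comp (measurable_pi_apply t)
  have hI : ∀ x, I x = 0 ∨ I x = 1 := fun x => Set.indicator_eq_zero_or_self _ _ _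
  have hIint : Integrable I (τ.instanceLaw ph σ) :=
    Integrable.of_bound (C := 1) hImeas.aestronglyMeasurable
      (Filter.Eventually.of_forall fun x => by rcases hI x with h | h <;> simp [h])
  have hIQ : Integrable (fun x => I x * τ.secondMoment ph n t σ x) (τ.instanceLaw ph σ) := by
    refine Integrable.of_bound (C := 2 ^ T)
      (hImeas.mul (τ.measurable_secondMoment n t σ)).aestronglyMeasurable
      (Filter.Eventually.of_forall fun x => ?_)
    have h2 := τ.secondMoment_nonneg (ph := ph) n t σ x
    have h3 := τ.secondMoment_le (ph := ph) n t σ x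
    rcases hI x with h | h
    · simp [h]
    · rw [h, one_mul, Real.norm_eq_abs, abs_of_nonneg h2]
      exact h3
  -- A prediction errs for exactly one of the two values of the bit, so the two averages add up to
  -- `1`, and `3/4 - 2 * (Q - 1) = 11/4 - 2 * Q` for the second moment `Q`.
  have hsum : ∀ x, τ.roundBound ph n t a (σ (ph t)) σ x + τ.roundBound ph n t a (!σ (ph t)) σ x =
      11 / 4 * I x - 2 * (I x * τ.secondMoment ph n t σ x) := by
    intro x
    have h1 : prodAvg (fun s => bitWeight (if ph s < ph t then τ.meanSign ph n σ x s else 0))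
          (fun v => zeroOneLoss (a x v) (σ (ph t))) +
        prodAvg (fun s => bitWeight (if ph s < ph t then τ.meanSign ph n σ x s else 0))
          (fun v => zeroOneLoss (a x v) (!σ (ph t))) = 1 := by
      rw [← prodAvg_add]
      simp only [zeroOneLoss_add_not]
      exact prodAvg_const (fun s => sum_bitWeight _) 1
    unfold roundBound
    linear_combination (3 / 4 * I x) * h1
  have hIval : ∫ x, I x ∂(τ.instanceLaw ph σ) = τ.mass (ph t) σ := by
    have h := integral_map (μ := τ.instanceLaw ph σ) (measurable_pi_apply t).aemeasurable
      (f := (τ.node (ph t) σ).indicator fun _ => (1 : ℝ))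
      (measurable_const.indicator (τ.measurableSet_node _ _)).aestronglyMeasurable
    have hmap : (τ.instanceLaw ph σ).map (fun x => x t) = (τ.law (ph t) σ : Measure X) :=
      (measurePreserving_eval (fun s => (τ.law (ph s) σ : Measure X)) t).map_eq
    rw [hmap, integral_indicator_const _ (τ.measurableSet_node _ _)] at h
    simpa [mass] using h.symm
  have hmain : 1 / 2 * τ.mass (ph t) σ ≤
      ∫ x, τ.roundBound ph n t a (σ (ph t)) σ x ∂(τ.instanceLaw ph σ) +
        ∫ x, τ.roundBound ph n t a (!σ (ph t)) σ x ∂(τ.instanceLaw ph σ) := by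
    rw [← integral_add (τ.integrable_roundBound n hm _ _ _) (τ.integrable_roundBound n hm _ _ _)]
    simp only [hsum]
    rw [integral_sub (hIint.const_mul _) (hIQ.const_mul _), integral_const_mul,
      integral_const_mul, hIval]
    have := τ.integral_indicator_mul_secondMoment_le (ph := ph) n t σ hn
    simp only [I]
    linarith
  -- The constant is `11/4 - 2 * 9/8 = 1/2`.
  nlinarith [mul_le_mul_of_nonneg_left hmain (τ.bias_pos n (ph t) σ).le]

end LabelTree

/-! ### Measurability and bounds for losses and regret -/

theorem bitWeight_pos {l : ℝ} (hl : |l| < 1) (b : Bool) : 0 < bitWeight l b := by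
  have := abs_lt.mp hl
  cases b <;> simp [bitWeight, boolSign] <;> linarith

section Bounds

variable {X : Type u} [MeasurableSpace X] {U : Set (ProbabilityMeasure X)} {T : ℕ}

theorem sum_zeroOneLoss_mem_Icc (f g : Fin T → Bool) :
    0 ≤ ∑ t, zeroOneLoss (f t) (g t) ∧ ∑ t, zeroOneLoss (f t) (g t) ≤ T := by
  refine ⟨Finset.sum_nonneg fun t _ => zeroOneLoss_nonneg _ _, ?_⟩
  calc ∑ t, zeroOneLoss (f t) (g t) ≤ ∑ _t : Fin T, (1 : ℝ) :=
        Finset.sum_le_sum fun t _ => zeroOneLoss_le_one _ _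
    _ = T := by simp

theorem bestLoss_le {F : Set (X → Bool)} (adv : ObliviousAdversary U T) (x : Fin T → X)
    {f : X → Bool} (hf : f ∈ F) :
    bestLoss F adv x ≤ ∑ t, zeroOneLoss (f (x t)) (adv.label t (x t)) :=
  ciInf_le ⟨0, by rintro _ ⟨g, rfl⟩; exact (sum_zeroOneLoss_mem_Icc _ _).1⟩ (⟨f, hf⟩ : F)

theorem bestLoss_nonneg (F : Set (X → Bool)) (adv : ObliviousAdversary U T) (x : Fin T → X) :
    0 ≤ bestLoss F adv x :=
  Real.iInf_nonneg fun _ => (sum_zeroOneLoss_mem_Icc _ _).1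

theorem measurable_label_comp (adv : ObliviousAdversary U T) (t : Fin T) :
    Measurable fun x : Fin T → X => adv.label t (x t) :=
  (adv.measurable_label t).comp (measurable_pi_apply t)

theorem measurable_predict_history (alg : OnlineAlgorithm.{u, v} X)
    (adv : ObliviousAdversary U T) (t : Fin T) :
    Measurable fun p : alg.Seed × (Fin T → X) =>
      alg.predict t p.1 (history adv p.2 t) (p.2 t) := by
  refine (alg.measurable_predict t).comp (measurable_fst.prodMk (Measurable.prodMk ?_
    ((measurable_pi_apply t).comp measurable_snd)))
  refine measurable_pi_lambda _ fun s => Measurable.prodMk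
    ((measurable_pi_apply _).comp measurable_snd) ((measurable_label_comp adv _).comp measurable_snd)

theorem measurable_learnerLoss (alg : OnlineAlgorithm.{u, v} X) (adv : ObliviousAdversary U T) :
    Measurable fun p : alg.Seed × (Fin T → X) => learnerLoss alg adv p.1 p.2 :=
  Finset.measurable_fun_sum _ fun t _ => LabelTree.measurable_zeroOneLoss
    (measurable_predict_history alg adv t) ((measurable_label_comp adv t).comp measurable_snd)

theorem measurable_bestLoss {F : Set (X → Bool)} (hF : F.Countable) (hm : ∀ f ∈ F, Measurable f)
    (adv : ObliviousAdversary U T) : Measurable (bestLoss F adv) := by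
  have : Countable F := hF
  exact Measurable.iInf fun f => Finset.measurable_fun_sum _ fun t _ =>
    LabelTree.measurable_zeroOneLoss ((hm f f.2).comp (measurable_pi_apply t))
      (measurable_label_comp adv t)

instance (alg : OnlineAlgorithm.{u, v} X) (adv : ObliviousAdversary U T) :
    IsProbabilityMeasure (interactionLaw alg adv) := by
  unfold interactionLaw; infer_instance

theorem integrable_realizedRegret (alg : OnlineAlgorithm.{u, v} X) {F : Set (X → Bool)}
    (hF : F.Countable) (hne : F.Nonempty) (hm : ∀ f ∈ F, Measurable f)
    (adv : ObliviousAdversary U T) :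
    Integrable (realizedRegret alg F adv) (interactionLaw alg adv) := by
  refine Integrable.of_bound (C := T) ((measurable_learnerLoss alg adv).sub
    ((measurable_bestLoss hF hm adv).comp measurable_snd)).aestronglyMeasurable
    (Filter.Eventually.of_forall fun p => ?_)
  obtain ⟨f, hf⟩ := hne
  have h1 := bestLoss_nonneg F adv p.2
  have h2 := (bestLoss_le adv p.2 hf).trans (sum_zeroOneLoss_mem_Icc _ _).2
  have h3 : 0 ≤ learnerLoss alg adv p.1 p.2 ∧ learnerLoss alg adv p.1 p.2 ≤ T :=
    sum_zeroOneLoss_mem_Icc _ _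
  rw [realizedRegret, Real.norm_eq_abs, abs_le]
  constructor <;> linarith

end Bounds

/-! ### Random labels from an oblivious adversary, and averaging over targets -/

namespace LabelTree

variable {X : Type u} [MeasurableSpace X] {U : Set (ProbabilityMeasure X)} {D T : ℕ}
  (τ : LabelTree U D) (ph : Fin T → Fin D) (n : ℕ)

open Classical in
/-- The adversary that labels the node of round `t` by the first and the other points by the second
bit of `c t`. -/
noncomputable def adversary (σ : Fin D → Bool) (c : Fin T → Bool × Bool) :
    ObliviousAdversary U T where
  dist t := τ.law (ph t) σ
  dist_mem _ := τ.law_mem _ _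
  label t x := if x ∈ τ.node (ph t) σ then (c t).1 else (c t).2
  measurable_label _ :=
    Measurable.ite (τ.measurableSet_node _ _) measurable_const measurable_const

/-- The probability that the adversary for the target `fn σ` chooses the bits `c` in round `s`. -/
noncomputable def choiceWeight (σ : Fin D → Bool) (s : Fin T) (c : Bool × Bool) : ℝ :=
  bitWeight (τ.bias n (ph s) σ * boolSign (σ (ph s))) c.1 * bitWeight 0 c.2

theorem choiceWeight_pos (σ : Fin D → Bool) (s : Fin T) (c : Bool × Bool) :
    0 < τ.choiceWeight ph n σ s c := by
  refine mul_pos (bitWeight_pos ?_ _) (bitWeight_pos (by simp) _)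
  rw [abs_mul, abs_boolSign, mul_one, abs_of_pos (τ.bias_pos n _ σ)]
  exact τ.bias_lt_one n _ σ

theorem sum_choiceWeight (σ : Fin D → Bool) (s : Fin T) :
    ∑ c, τ.choiceWeight ph n σ s c = 1 := by
  simp only [choiceWeight, Fintype.sum_prod_type, ← Finset.mul_sum, sum_bitWeight, mul_one]

open Classical in
-- An instance reveals only one of the two coins of its round, so coins tossed in advance simulate
-- noisy labels.
theorem sum_choiceWeight_label (σ : Fin D → Bool) (x : Fin T → X) (s : Fin T) (b : Bool) :
    ∑ c : Bool × Bool, (if (if x s ∈ τ.node (ph s) σ then c.1 else c.2) = b then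
      τ.choiceWeight ph n σ s c else 0) = bitWeight (τ.meanSign ph n σ x s) b := by
  by_cases h : x s ∈ τ.node (ph s) σ <;> cases b <;>
    simp [h, meanSign, choiceWeight, bitWeight, boolSign, Fintype.sum_prod_type] <;> ring

/-- The predictions of an algorithm as a function of the instances and the labels. -/
def prediction (alg : OnlineAlgorithm.{u, v} X) (t : Fin T) (ω : alg.Seed) (x : Fin T → X)
    (v : Fin T → Bool) : Bool :=
  alg.predict t ω (fun s => (x (s.castLE t.isLt.le), v (s.castLE t.isLt.le))) (x t)

theorem prediction_dependsOn (alg : OnlineAlgorithm.{u, v} X) (t : Fin T) (ω : alg.Seed)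
    (x x' : Fin T → X) (v v' : Fin T → Bool) (hx : ∀ s ≤ t, x s = x' s)
    (hv : ∀ s < t, v s = v' s) : prediction alg t ω x v = prediction alg t ω x' v' := by
  have hlt : ∀ s : Fin (t : ℕ), s.castLE t.isLt.le < t := fun s => s.isLt
  unfold prediction
  rw [hx t le_rfl]
  congr 1
  funext s
  rw [hx _ (hlt s).le, hv _ (hlt s)]

theorem measurable_prediction (alg : OnlineAlgorithm.{u, v} X) (t : Fin T) (v : Fin T → Bool) :
    Measurable fun p : alg.Seed × (Fin T → X) => prediction alg t p.1 p.2 v := by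
  refine (alg.measurable_predict t).comp (measurable_fst.prodMk (Measurable.prodMk ?_
    ((measurable_pi_apply t).comp measurable_snd)))
  exact measurable_pi_lambda _ fun s => Measurable.prodMk
    ((measurable_pi_apply _).comp measurable_snd) measurable_const

/-- The difference of the losses of the algorithm and of the target. -/
noncomputable def excess (alg : OnlineAlgorithm.{u, v} X) (σ : Fin D → Bool)
    (c : Fin T → Bool × Bool) (p : alg.Seed × (Fin T → X)) : ℝ :=
  learnerLoss alg (τ.adversary ph σ c) p.1 p.2 -
    ∑ t, zeroOneLoss (τ.fn σ (p.2 t)) ((τ.adversary ph σ c).label t (p.2 t))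

/-- The prediction in round `t` is independent of the label in that round, and the difference of the
two losses is linear in the sign of this label. Its mean vanishes off the node; on the node it is
the bias times the sign of the bit that the target predicts. -/
theorem prodAvg_excess (alg : OnlineAlgorithm.{u, v} X) (σ : Fin D → Bool)
    (p : alg.Seed × (Fin T → X)) :
    prodAvg (τ.choiceWeight ph n σ) (fun c => τ.excess ph alg σ c p) =
      ∑ t, τ.roundExcess ph n t (prediction alg t p.1) σ p.2 := by
  classical
  obtain ⟨ω, x⟩ := p
  have h := prodAvg_map (τ.choiceWeight ph n σ)
    (fun s (c : Bool × Bool) => if x s ∈ τ.node (ph s) σ then c.1 else c.2)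
    fun v => ∑ t, (zeroOneLoss (prediction alg t ω x v) (v t) - zeroOneLoss (τ.fn σ (x t)) (v t))
  have h1 : (fun c => τ.excess ph alg σ c (ω, x)) = fun c : Fin T → Bool × Bool =>
      ∑ t, (zeroOneLoss (prediction alg t ω x
          fun s => if x s ∈ τ.node (ph s) σ then (c s).1 else (c s).2)
          (if x t ∈ τ.node (ph t) σ then (c t).1 else (c t).2) -
        zeroOneLoss (τ.fn σ (x t)) (if x t ∈ τ.node (ph t) σ then (c t).1 else (c t).2)) := by
    funext c
    rw [Finset.sum_sub_distrib]
    unfold excess learnerLoss adversary prediction history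
    congr!
  rw [h1, h, prodAvg_sum]
  refine Finset.sum_congr rfl fun t _ => ?_
  have h2 : (fun s b => ∑ c : Bool × Bool, if (if x s ∈ τ.node (ph s) σ then c.1 else c.2) = b then
      τ.choiceWeight ph n σ s c else 0) = fun s => bitWeight (τ.meanSign ph n σ x s) := by
    funext s b
    exact τ.sum_choiceWeight_label ph n σ x s b
  have h3 : (fun v : Fin T → Bool => zeroOneLoss (prediction alg t ω x v) (v t) -
      zeroOneLoss (τ.fn σ (x t)) (v t)) = fun v =>
      (boolSign (τ.fn σ (x t)) - boolSign (prediction alg t ω x v)) / 2 * boolSign (v t) := by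
    funext v
    rw [zeroOneLoss_eq, zeroOneLoss_eq]
    ring
  have h4 : ∑ b, bitWeight (τ.meanSign ph n σ x t) b * boolSign b = τ.meanSign ph n σ x t := by
    simp [bitWeight, boolSign]; ring
  rw [h2, h3, prodAvg_mul_coord (fun s => sum_bitWeight _) t (fun v w hvw => ?_), h4]
  · unfold roundExcess
    by_cases hx : x t ∈ τ.node (ph t) σ
    · rw [Set.indicator_of_mem hx, meanSign, Set.indicator_of_mem hx, mul_comm,
        mul_assoc, ← prodAvg_const_mul]
      congr 2
      funext v
      rw [τ.fn_of_mem _ _ _ hx, zeroOneLoss_eq]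
      linear_combination boolSign_sq (σ (ph t)) / 2
    · simp [meanSign, Set.indicator_of_notMem hx]
  · rw [prediction_dependsOn alg t ω x x v w (fun _ _ => rfl) fun s hs => hvw s hs.ne]

theorem measurable_excess (alg : OnlineAlgorithm.{u, v} X) (σ : Fin D → Bool)
    (c : Fin T → Bool × Bool) : Measurable (τ.excess ph alg σ c) :=
  (measurable_learnerLoss alg _).sub (Finset.measurable_fun_sum _ fun t _ =>
    measurable_zeroOneLoss ((τ.measurable_fn σ).comp ((measurable_pi_apply t).comp measurable_snd))
      ((measurable_label_comp _ t).comp measurable_snd))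

theorem integrable_excess (alg : OnlineAlgorithm.{u, v} X) (σ : Fin D → Bool)
    (c : Fin T → Bool × Bool) (P : Measure (alg.Seed × (Fin T → X))) [IsFiniteMeasure P] :
    Integrable (τ.excess ph alg σ c) P := by
  refine Integrable.of_bound (C := T) (τ.measurable_excess ph alg σ c).aestronglyMeasurable
    (Filter.Eventually.of_forall fun p => ?_)
  have h2 := sum_zeroOneLoss_mem_Icc (fun t => τ.fn σ (p.2 t))
    fun t => (τ.adversary ph σ c).label t (p.2 t)
  have h3 : 0 ≤ learnerLoss alg (τ.adversary ph σ c) p.1 p.2 ∧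
    learnerLoss alg (τ.adversary ph σ c) p.1 p.2 ≤ T := sum_zeroOneLoss_mem_Icc _ _
  rw [excess, Real.norm_eq_abs, abs_le]
  constructor <;> linarith

/-- The regret averaged over the random choices of the adversary for the target `fn σ`. -/
theorem sum_integral_roundExcess_le (alg : OnlineAlgorithm.{u, v} X) (σ : Fin D → Bool) :
    ∑ t, ∫ ω, ∫ x, τ.roundExcess ph n t (prediction alg t ω) σ x ∂(τ.instanceLaw ph σ)
        ∂alg.seedLaw ≤
      prodAvg (τ.choiceWeight ph n σ) fun c =>
        regret alg (Set.range τ.fn) (τ.adversary ph σ c) := by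
  have hint : ∀ t, Integrable (fun p : alg.Seed × (Fin T → X) =>
      τ.roundExcess ph n t (prediction alg t p.1) σ p.2) (alg.seedLaw.prod (τ.instanceLaw ph σ)) :=
    fun t => τ.integrable_roundExcess n measurable_snd (measurable_prediction alg t) σ _
  have h1 : ∀ c, ∫ p, τ.excess ph alg σ c p ∂(alg.seedLaw.prod (τ.instanceLaw ph σ)) ≤
      regret alg (Set.range τ.fn) (τ.adversary ph σ c) := by
    intro c
    refine integral_mono (τ.integrable_excess ph alg σ c _)
      (integrable_realizedRegret alg (Set.countable_range _) (Set.range_nonempty _)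
        (by rintro _ ⟨ρ, rfl⟩; exact τ.measurable_fn ρ) _) fun p => ?_
    have := bestLoss_le (τ.adversary ph σ c) p.2 (Set.mem_range_self (f := τ.fn) σ)
    simp only [excess, realizedRegret]
    linarith
  calc _ = ∑ t, ∫ p : alg.Seed × (Fin T → X), τ.roundExcess ph n t (prediction alg t p.1) σ p.2
        ∂(alg.seedLaw.prod (τ.instanceLaw ph σ)) :=
        Finset.sum_congr rfl fun t _ => (integral_prod _ (hint t)).symm
    _ = ∫ p, prodAvg (τ.choiceWeight ph n σ) (fun c => τ.excess ph alg σ c p)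
        ∂(alg.seedLaw.prod (τ.instanceLaw ph σ)) := by
        rw [← integral_finsetSum _ fun t _ => hint t]
        simp only [prodAvg_excess]
    _ = prodAvg (τ.choiceWeight ph n σ) fun c =>
        ∫ p, τ.excess ph alg σ c p ∂(alg.seedLaw.prod (τ.instanceLaw ph σ)) := by
        unfold prodAvg
        rw [integral_finsetSum _ fun c _ => (τ.integrable_excess ph alg σ c _).const_mul _]
        simp only [integral_const_mul]
    _ ≤ _ := prodAvg_mono (fun s c => (τ.choiceWeight_pos ph n σ s c).le) h1

/-- The flip of the bit `k`. -/
def flipBit (k : Fin D) : Equiv.Perm (Fin D → Bool) :=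
  Function.Involutive.toPerm (fun σ => Function.update σ k (!σ k)) fun σ => by
    simp

variable {ph n}

/-- Flipping the bit of the phase permutes the targets, so summing the two-target bound over all `σ`
counts every target twice. -/
theorem sum_integral_roundExcess_ge (hph : Monotone ph) (hn : 1 ≤ n) (t : Fin T)
    (hcard : (Finset.univ.filter fun s => s < t ∧ ph s = ph t).card ≤ n) {r : ℝ} (hr : 0 ≤ r)
    (hmass : ∀ k σ, r ≤ τ.mass k σ) (alg : OnlineAlgorithm.{u, v} X) :
    2 ^ D * (min r (Real.sqrt (r / n)) / 16) ≤
      ∑ σ, ∫ ω, ∫ x, τ.roundExcess ph n t (prediction alg t ω) σ x ∂(τ.instanceLaw ph σ)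
        ∂alg.seedLaw := by
  set E : (Fin D → Bool) → alg.Seed → ℝ := fun σ ω =>
    ∫ x, τ.roundExcess ph n t (prediction alg t ω) σ x ∂(τ.instanceLaw ph σ) with hE
  have hint : ∀ σ, Integrable (E σ) alg.seedLaw := fun σ =>
    (τ.integrable_roundExcess (ph := ph) (t := t) (a := fun p => prediction alg t p.1) n
      measurable_snd (measurable_prediction alg t) σ
      (alg.seedLaw.prod (τ.instanceLaw ph σ))).integral_prod_left
  have hpair : ∀ σ, min r (Real.sqrt (r / n)) / 8 ≤
      ∫ ω, E σ ω ∂alg.seedLaw + ∫ ω, E (flipBit (ph t) σ) ω ∂alg.seedLaw := by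
    intro σ
    rw [← integral_add (hint _) (hint _)]
    calc min r (Real.sqrt (r / n)) / 8
        = ∫ _, min r (Real.sqrt (r / n)) / 8 ∂alg.seedLaw := by simp
      _ ≤ _ := by
        refine integral_mono (integrable_const _) ((hint _).add (hint _)) fun ω => ?_
        have h1 := τ.integral_roundExcess_add_ge n hph (prediction_dependsOn alg t ω)
          (fun v => (measurable_prediction alg t v).comp measurable_prodMk_left) σ hcard
        have h2 := τ.bias_mul_mass_ge hn hr (ph t) σ (hmass _ _)
        exact le_trans (by linarith) h1
  have hsum := Finset.sum_le_sum fun σ (_ : σ ∈ Finset.univ) => hpair σ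
  rw [Finset.sum_add_distrib, Equiv.sum_comp (flipBit (ph t)) fun σ => ∫ ω, E σ ω ∂alg.seedLaw,
    Finset.sum_const, Finset.card_univ, Fintype.card_fun, Fintype.card_bool, Fintype.card_fin,
    nsmul_eq_mul] at hsum
  push_cast at hsum
  linarith

/-- Every algorithm has large regret against some adversary for a label tree. -/
theorem exists_regret_ge (hph : Monotone ph) (hn : 1 ≤ n)
    (hcard : ∀ t, (Finset.univ.filter fun s => s < t ∧ ph s = ph t).card ≤ n) {r : ℝ} (hr : 0 ≤ r)
    (hmass : ∀ k σ, r ≤ τ.mass k σ) (alg : OnlineAlgorithm.{u, v} X) :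
    ∃ adv : ObliviousAdversary U T,
      Integrable (realizedRegret alg (Set.range τ.fn) adv) (interactionLaw alg adv) ∧
        T * (min r (Real.sqrt (r / n)) / 16) ≤ regret alg (Set.range τ.fn) adv := by
  set C := T * (min r (Real.sqrt (r / n)) / 16)
  let w : (Fin D → Bool) × (Fin T → Bool × Bool) → ℝ := fun z =>
    ∏ s, τ.choiceWeight ph n z.1 s (z.2 s)
  have hw : ∀ z, 0 < w z := fun z => Finset.prod_pos fun s _ => τ.choiceWeight_pos ph n _ s _
  have hle : ∑ z, w z * C ≤ ∑ z, w z * regret alg (Set.range τ.fn) (τ.adversary ph z.1 z.2) := by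
    rw [Fintype.sum_prod_type, Fintype.sum_prod_type]
    calc ∑ σ : Fin D → Bool, ∑ c, w (σ, c) * C = ∑ _σ : Fin D → Bool, C :=
          Finset.sum_congr rfl fun σ _ => prodAvg_const (τ.sum_choiceWeight ph n σ) C
      _ = ∑ _t : Fin T, 2 ^ D * (min r (Real.sqrt (r / n)) / 16) := by
          simp [C]; ring
      _ ≤ ∑ t : Fin T, ∑ σ, ∫ ω, ∫ x, τ.roundExcess ph n t (prediction alg t ω) σ x
            ∂(τ.instanceLaw ph σ) ∂alg.seedLaw :=
          Finset.sum_le_sum fun t _ =>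
            τ.sum_integral_roundExcess_ge hph hn t (hcard t) hr hmass alg
      _ ≤ _ := by
          rw [Finset.sum_comm]
          exact Finset.sum_le_sum fun σ _ => τ.sum_integral_roundExcess_le ph n alg σ
  -- The weighted average of the regret over targets and coins is large, so some fixed pair does as
  -- well; positivity of its weight allows cancelling it.
  obtain ⟨z, -, hz⟩ := Finset.exists_le_of_sum_le Finset.univ_nonempty hle
  exact ⟨τ.adversary ph z.1 z.2, integrable_realizedRegret alg (Set.countable_range _)
    (Set.range_nonempty _) (by rintro _ ⟨ρ, rfl⟩; exact τ.measurable_fn ρ) _,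
    le_of_mul_le_mul_left hz (hw z)⟩

end LabelTree

/-! ### Extracting sets and laws from the fragmentation number -/

section Fragmentation

variable {X : Type u} [MeasurableSpace X] {U : Set (ProbabilityMeasure X)}

theorem exists_fragments {ε : ℝ} {m : ℕ} (h : (m : ℕ∞) ≤ fragmentationNumber U ε) :
    ∃ A : Fin m → Set X, (∀ i, MeasurableSet (A i)) ∧
      (Pairwise fun i j => Disjoint (A i) (A j)) ∧ ∀ i, ENNReal.ofReal ε ≤ envelope U (A i) := by
  cases m with
  | zero => exact ⟨fun _ => ∅, fun i => i.elim0, fun i => i.elim0, fun i => i.elim0⟩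
  | succ m =>
    have hlt : (m : ℕ∞) < fragmentationNumber U ε :=
      lt_of_lt_of_le (by exact_mod_cast m.lt_succ_self) h
    simp only [fragmentationNumber, lt_iSup_iff] at hlt
    obtain ⟨k, ⟨A, hA, hd, hε⟩, hk⟩ := hlt
    have hk' : m + 1 ≤ k := by exact_mod_cast hk
    exact ⟨fun i => A (i.castLE hk'), fun i => hA _,
      fun i j hij => hd fun h => hij (Fin.castLE_injective hk' h), fun i => hε _⟩

theorem envelope_le_one (A : Set X) : envelope U A ≤ 1 :=
  iSup₂_le fun _ _ => prob_le_one

theorem le_one_of_fragmentationNumber_pos {ε : ℝ} (h : 0 < fragmentationNumber U ε) : ε ≤ 1 := by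
  obtain ⟨A, -, -, hε⟩ := exists_fragments (m := 1)
    (by exact_mod_cast Order.one_le_iff_pos.mpr h)
  simpa using (hε 0).trans (envelope_le_one _)

/-- The supremum over `U` need not be attained; the factor `1 / 2` pays for this. -/
theorem exists_measure_ge_half {ε : ℝ} (hε : 0 < ε) {A : Set X}
    (h : ENNReal.ofReal ε ≤ envelope U A) : ∃ μ ∈ U, ε / 2 ≤ (μ : Measure X).real A := by
  have hlt : ENNReal.ofReal (ε / 2) < envelope U A :=
    lt_of_lt_of_le ((ENNReal.ofReal_lt_ofReal_iff hε).mpr (by linarith)) h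
  simp only [envelope, lt_iSup_iff] at hlt
  obtain ⟨μ, hμ, hlt⟩ := hlt
  exact ⟨μ, hμ, (ENNReal.ofReal_le_iff_le_toReal (measure_ne_top _ _)).mp hlt.le⟩

end Fragmentation

/-! ### The class of branches and its VC dimension -/

section BranchClass

variable {X : Type u} [MeasurableSpace X] {d L : ℕ}

/-- The node reached by the bits `σ` at the index `k`, in a forest of `d` binary trees of depth `L`:
the tree, the level in it, and the bits chosen at the previous levels, padded by `false`. -/
def branchNode (k : Fin (d * L)) (σ : Fin (d * L) → Bool) : Fin d × Fin L × (Fin L → Bool) :=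
  ((finProdFinEquiv.symm k).1, (finProdFinEquiv.symm k).2,
    fun l => if l < (finProdFinEquiv.symm k).2 then
      σ (finProdFinEquiv ((finProdFinEquiv.symm k).1, l)) else false)

theorem branchNode_index {k k' : Fin (d * L)} {σ σ' : Fin (d * L) → Bool}
    (h : branchNode k σ = branchNode k' σ') : k = k' := by
  simp only [branchNode, Prod.mk.injEq] at h
  exact finProdFinEquiv.symm.injective (Prod.ext h.1 h.2.1)

theorem branchNode_congr {k : Fin (d * L)} {σ σ' : Fin (d * L) → Bool}
    (h : ∀ j < k, σ j = σ' j) : branchNode k σ = branchNode k σ' := by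
  obtain ⟨⟨j, l⟩, rfl⟩ := finProdFinEquiv.surjective k
  simp only [branchNode, Equiv.symm_apply_apply, Prod.mk.injEq, true_and]
  funext l'
  split_ifs with hl
  · refine h _ ?_
    -- The pair `(j, l)` has index `l + L * j`, so higher levels of a tree come earlier in the order
    -- of the phases.
    rw [Fin.lt_def, finProdFinEquiv_apply_val, finProdFinEquiv_apply_val]
    exact Nat.add_lt_add_right hl _
  · rfl

/-- If two families of branches meet at a node where `σ` turns right, then at each node above it in
its tree where `σ'` turns right, they meet and `σ` turns right, too. -/
theorem branchNode_of_le {j : Fin d} {l l' : Fin L} (hl : l ≤ l') {σ σ' : Fin (d * L) → Bool}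
    (h : branchNode (finProdFinEquiv (j, l')) σ = branchNode (finProdFinEquiv (j, l')) σ')
    (h1 : σ (finProdFinEquiv (j, l')) = true) (h2 : σ' (finProdFinEquiv (j, l)) = true) :
    branchNode (finProdFinEquiv (j, l)) σ = branchNode (finProdFinEquiv (j, l)) σ' ∧
      σ (finProdFinEquiv (j, l)) = true := by
  simp only [branchNode, Equiv.symm_apply_apply, Prod.mk.injEq, true_and] at h ⊢
  have h3 : ∀ i < l', σ (finProdFinEquiv (j, i)) = σ' (finProdFinEquiv (j, i)) := fun i hi => by
    simpa [hi] using congrFun h i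
  constructor
  · funext i
    split_ifs with hi
    · exact h3 i (hi.trans_le hl)
    · rfl
  · rcases hl.lt_or_eq with h4 | rfl
    · rw [h3 l h4, h2]
    · exact h1

open Classical in
/-- The indicator of the union of the sets at the nodes of the branches `σ` at which the branches
turn right. -/
noncomputable def branchFn (A : Fin d × Fin L × (Fin L → Bool) → Set X) (σ : Fin (d * L) → Bool)
    (x : X) : Bool :=
  decide (∃ k, σ k = true ∧ x ∈ A (branchNode k σ))

omit [MeasurableSpace X] in
theorem branchFn_eq_true_iff {A : Fin d × Fin L × (Fin L → Bool) → Set X}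
    {σ : Fin (d * L) → Bool} {x : X} :
    branchFn A σ x = true ↔ ∃ k, σ k = true ∧ x ∈ A (branchNode k σ) := by
  simp [branchFn]

theorem measurable_branchFn {A : Fin d × Fin L × (Fin L → Bool) → Set X}
    (hA : ∀ i, MeasurableSet (A i)) (σ : Fin (d * L) → Bool) : Measurable (branchFn A σ) := by
  refine measurable_to_bool ?_
  have : branchFn A σ ⁻¹' {true} = ⋃ k, {x | σ k = true ∧ x ∈ A (branchNode k σ)} := by
    ext x
    simp [branchFn_eq_true_iff]
  rw [this]
  exact MeasurableSet.iUnion fun k => (MeasurableSet.const _).inter (hA _)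

omit [MeasurableSpace X] in
-- By disjointness `x` lies in no other node of the branches `σ`, so the bit at `k` alone decides.
theorem branchFn_of_mem {A : Fin d × Fin L × (Fin L → Bool) → Set X}
    (hd : Pairwise fun i j => Disjoint (A i) (A j)) {k : Fin (d * L)} {σ : Fin (d * L) → Bool}
    {x : X} (hx : x ∈ A (branchNode k σ)) : branchFn A σ x = σ k := by
  rw [Bool.eq_iff_iff, branchFn_eq_true_iff]
  refine ⟨fun ⟨k', hk', hx'⟩ => ?_, fun h => ⟨k, h, hx⟩⟩
  have : branchNode k' σ = branchNode k σ := by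
    by_contra hne
    exact Set.disjoint_left.mp (hd hne) hx' hx
  rwa [← branchNode_index this]

omit [MeasurableSpace X] in
-- Let `σ` realise the all-true pattern on more than `d` points. Two of them lie in right-turn nodes
-- of one tree. Any `ρ` that is true at the deeper point follows `σ` down to its node and turns
-- right there, so it is true at the upper point too; the pattern that is true at the deeper point
-- only is missed.
theorem vcDim_branchFn_le {A : Fin d × Fin L × (Fin L → Bool) → Set X}
    (hd : Pairwise fun i j => Disjoint (A i) (A j)) : vcDim (Set.range (branchFn A)) ≤ d := by
  refine iSup₂_le fun n ⟨x, hx⟩ => ?_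
  have huniv : (fun (f : X → Bool) (i : Fin n) => f (x i)) '' Set.range (branchFn A) =
      Set.univ := by
    refine Set.eq_of_subset_of_ncard_le (Set.subset_univ _) ?_ Set.finite_univ
    rw [hx, Set.ncard_univ, Nat.card_eq_fintype_card]
    simp
  have hall : ∀ p : Fin n → Bool, ∃ σ, ∀ i, branchFn A σ (x i) = p i := by
    intro p
    obtain ⟨_, ⟨σ, rfl⟩, h⟩ := huniv.symm.subset (Set.mem_univ p)
    exact ⟨σ, congrFun h⟩
  obtain ⟨σ, hσ⟩ := hall fun _ => true
  have hk : ∀ i, ∃ k : Fin d × Fin L, σ (finProdFinEquiv k) = true ∧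
      x i ∈ A (branchNode (finProdFinEquiv k) σ) := by
    intro i
    obtain ⟨k, hk⟩ := branchFn_eq_true_iff.mp (hσ i)
    exact ⟨finProdFinEquiv.symm k, by rwa [Equiv.apply_symm_apply]⟩
  choose κ hκ using hk
  by_contra hlt
  have hlt' : d < n := by exact_mod_cast not_le.mp hlt
  obtain ⟨i, i', hne, heq⟩ := Fintype.exists_ne_map_eq_of_card_lt (fun i => (κ i).1)
    (by simpa using hlt')
  wlog hle : (κ i).2 ≤ (κ i').2 generalizing i i'
  · exact this i' i hne.symm heq.symm (le_of_not_ge hle)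
  obtain ⟨ρ, hρ⟩ := hall fun j => decide (j = i')
  obtain ⟨k, hk1, hk2⟩ := branchFn_eq_true_iff.mp ((hρ i').trans (by simp))
  have hnode : branchNode k ρ = branchNode (finProdFinEquiv (κ i')) σ := by
    by_contra hne
    exact Set.disjoint_left.mp (hd hne) hk2 (hκ i').2
  obtain rfl := branchNode_index hnode
  have e' : κ i' = ((κ i).1, (κ i').2) := Prod.ext heq.symm rfl
  rw [e'] at hnode hk1
  obtain ⟨h1, h2⟩ := branchNode_of_le hle hnode hk1 (hκ i).1
  have h3 : branchFn A ρ (x i) = true :=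
    branchFn_eq_true_iff.mpr ⟨finProdFinEquiv ((κ i).1, (κ i).2), h2, by rw [h1]; exact (hκ i).2⟩
  rw [hρ i] at h3
  exact hne (of_decide_eq_true h3)

end BranchClass

/-- The label tree of the branch functions. -/
noncomputable def branchTree {X : Type u} [MeasurableSpace X] {U : Set (ProbabilityMeasure X)}
    {d L : ℕ} {A : Fin d × Fin L × (Fin L → Bool) → Set X} (hA : ∀ i, MeasurableSet (A i))
    (hd : Pairwise fun i j => Disjoint (A i) (A j))
    {μ : Fin d × Fin L × (Fin L → Bool) → ProbabilityMeasure X} (hμ : ∀ i, μ i ∈ U) :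
    LabelTree U (d * L) where
  law k σ := μ (branchNode k σ)
  law_mem _ _ := hμ _
  node k σ := A (branchNode k σ)
  measurableSet_node _ _ := hA _
  fn := branchFn A
  measurable_fn := measurable_branchFn hA
  law_congr _ _ _ h := by rw [branchNode_congr h]
  node_congr _ _ _ h := by rw [branchNode_congr h]
  fn_of_mem _ _ _ hx := branchFn_of_mem hd hx

/-! ### Phase length, tree depth and the final constants -/

theorem min_sqrt_le_phase_bound {ε : ℝ} (hε : 0 < ε) (hε1 : ε ≤ 1) {D T n : ℕ} (hD : 1 ≤ D)
    (hn : 1 ≤ n) (hnT : n ≤ (T - 1) / D + 1) :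
    min (Real.sqrt (ε * D * T)) (ε * T) / 32 ≤
      T * (min (ε / 2) (Real.sqrt (ε / 2 / n)) / 16) := by
  have hT0 : (0 : ℝ) ≤ T := T.cast_nonneg
  rcases le_or_gt (ε / 2) (Real.sqrt (ε / 2 / n)) with h | h
  · rw [min_eq_left h]
    have := min_le_right (Real.sqrt (ε * D * T)) (ε * T)
    linarith
  rw [min_eq_right h.le]
  -- For `n = 1` the linear term would be the smaller one, as `ε ≤ 1`. Hence `(T - 1) / D ≥ 1`, and
  -- rounding up the phase length costs at most a factor `2`.
  have hn2 : n ≠ 1 := by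
    rintro rfl
    refine h.not_ge (Real.le_sqrt_of_sq_le ?_)
    rw [Nat.cast_one, div_one]
    nlinarith
  have hnat : n * D ≤ 2 * T := by
    have h1 := Nat.div_mul_le_self (T - 1) D
    have h2 : 1 ≤ (T - 1) / D := by omega
    have h3 : n * D ≤ ((T - 1) / D + 1) * D := Nat.mul_le_mul_right D hnT
    have h4 : 1 * D ≤ (T - 1) / D * D := Nat.mul_le_mul_right D h2
    rw [add_mul] at h3
    omega
  have hreal : (n : ℝ) * D ≤ 2 * T := by exact_mod_cast hnat
  have hn0 : (0 : ℝ) < n := by exact_mod_cast hn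
  have key : Real.sqrt (ε * D * T) / 2 ≤ T * Real.sqrt (ε / 2 / n) := by
    rw [show (T : ℝ) * Real.sqrt (ε / 2 / n) = Real.sqrt (T ^ 2 * (ε / 2 / n)) by
      rw [Real.sqrt_mul (sq_nonneg _), Real.sqrt_sq hT0]]
    refine Real.le_sqrt_of_sq_le ?_
    rw [div_pow, Real.sq_sqrt (by positivity), div_div, mul_div_assoc', le_div_iff₀ (by positivity)]
    nlinarith [mul_le_mul_of_nonneg_left hreal (mul_nonneg hε.le hT0)]
  have := min_le_left (Real.sqrt (ε * D * T)) (ε * T)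
  linarith

theorem card_phase_le {T n : ℕ} (hn : 1 ≤ n) (t : Fin T) (q : Fin T → Prop) [DecidablePred q]
    (hq : ∀ s, q s → (s : ℕ) / n = t / n) : (Finset.univ.filter q).card ≤ n := by
  have h : (Finset.univ.filter q).card ≤ (Finset.range n).card := by
    refine Finset.card_le_card_of_injOn (fun s => (s : ℕ) % n)
      (fun s _ => Finset.mem_coe.mpr (Finset.mem_range.mpr (Nat.mod_lt _ hn))) ?_
    intro s hs s' hs' hss
    have h1 := hq s (Finset.mem_filter.mp hs).2
    have h2 := hq s' (Finset.mem_filter.mp hs').2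
    refine Fin.ext ?_
    rw [← Nat.div_add_mod (s : ℕ) n, ← Nat.div_add_mod (s' : ℕ) n, h1, h2]
    exact congrArg _ hss
  simpa using h

/-- The lower bound for the phases of equal length. -/
theorem LabelTree.exists_regret_ge_of_mass {X : Type u} [MeasurableSpace X]
    {U : Set (ProbabilityMeasure X)} {D : ℕ} (τ : LabelTree U D) {ε : ℝ} (hε : 0 < ε)
    (hε1 : ε ≤ 1) (hD : 1 ≤ D) (hmass : ∀ k σ, ε / 2 ≤ τ.mass k σ) (T : ℕ)
    (alg : OnlineAlgorithm.{u, v} X) :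
    ∃ adv : ObliviousAdversary U T,
      Integrable (realizedRegret alg (Set.range τ.fn) adv) (interactionLaw alg adv) ∧
        min (Real.sqrt (ε * D * T)) (ε * T) / 32 ≤ regret alg (Set.range τ.fn) adv := by
  -- This is `T / D` rounded up for `T ≥ 1`, and `n ≥ 1` always; the last phases may be short or
  -- empty.
  obtain ⟨n, hn⟩ : ∃ n, n = (T - 1) / D + 1 := ⟨_, rfl⟩
  have hn1 : 1 ≤ n := hn ▸ Nat.le_add_left 1 _
  have hlt : ∀ t : Fin T, (t : ℕ) / n < D := by
    intro t
    refine Nat.div_lt_of_lt_mul ?_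
    have h1 := Nat.lt_div_mul_add (a := T - 1) hD
    have h2 := t.isLt
    rw [hn, add_mul, one_mul]
    omega
  obtain ⟨adv, hint, hadv⟩ := τ.exists_regret_ge (ph := fun t => ⟨(t : ℕ) / n, hlt t⟩) (n := n)
    (fun s t hst => Nat.div_le_div_right hst) hn1
    (fun t => card_phase_le hn1 t _ fun s hs => Fin.ext_iff.mp hs.2) (half_pos hε).le hmass alg
  exact ⟨adv, hint, (min_sqrt_le_phase_bound hε hε1 hD hn1 hn.le).trans hadv⟩

/-- The lower bound for the class of the branches of `d` binary trees of depth `L`. -/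
theorem exists_class_regret_ge {X : Type u} [MeasurableSpace X] {U : Set (ProbabilityMeasure X)}
    {ε : ℝ} (hε : 0 < ε) {d L : ℕ} (hd : 1 ≤ d) (hL : 1 ≤ L)
    (h : ((d * (L * 2 ^ L) : ℕ) : ℕ∞) ≤ fragmentationNumber U ε) :
    ∃ F : Set (X → Bool), F.Nonempty ∧ (∀ f ∈ F, Measurable f) ∧ vcDim F ≤ d ∧
      ∀ (T : ℕ) (alg : OnlineAlgorithm.{u, v} X), ∃ adv : ObliviousAdversary U T,
        Integrable (realizedRegret alg F adv) (interactionLaw alg adv) ∧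
          min (Real.sqrt (ε * (d * L : ℕ) * T)) (ε * T) / 32 ≤ regret alg F adv := by
  obtain ⟨A', hA', hdisj', hε'⟩ := exists_fragments h
  -- The padded indices number `L * 2 ^ L` per tree, more than the nodes reached; the surplus factor
  -- is harmless inside the logarithm.
  obtain ⟨e⟩ : Nonempty (Fin d × Fin L × (Fin L → Bool) ≃ Fin (d * (L * 2 ^ L))) :=
    ⟨Fintype.equivFinOfCardEq (by simp)⟩
  have hμ : ∀ i, ∃ μ ∈ U, ε / 2 ≤ (μ : Measure X).real (A' (e i)) := fun i =>
    exists_measure_ge_half hε (hε' (e i))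
  choose μ hμU hμ using hμ
  have hpos : 0 < d * (L * 2 ^ L) := by positivity
  have hε1 : ε ≤ 1 := le_one_of_fragmentationNumber_pos
    (lt_of_lt_of_le (Nat.cast_pos.mpr hpos) h)
  have hdisj : Pairwise fun i j => Disjoint (A' (e i)) (A' (e j)) := fun i j hij =>
    hdisj' (e.injective.ne hij)
  exact ⟨Set.range (branchFn fun i => A' (e i)), Set.range_nonempty _,
    Set.forall_mem_range.mpr (measurable_branchFn fun i => hA' (e i)), vcDim_branchFn_le hdisj,
    fun T alg => (branchTree (fun i => hA' (e i)) hdisj hμU).exists_regret_ge_of_mass hε hε1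
      (Nat.mul_pos hd hL) (fun k σ => hμ (branchNode k σ)) T alg⟩

/-- Take the largest `L` that fits. Its successor does not fit, so `ln (N / d) ≤ ln (L + 1) + (L +
1) * ln 2 ≤ 3 * L`. -/
theorem exists_depth {d N : ℕ} (hd : 1 ≤ d) (h : 3 * d ≤ N) :
    ∃ L : ℕ, 1 ≤ L ∧ d * (L * 2 ^ L) ≤ N ∧ Real.log ((N : ℝ) / d) ≤ 3 * L := by
  classical
  have hex : ∃ L : ℕ, N < d * ((L + 1) * 2 ^ (L + 1)) :=
    ⟨N, calc N < 2 ^ N := Nat.lt_two_pow_self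
      _ ≤ 2 ^ (N + 1) := Nat.pow_le_pow_right (by norm_num) (Nat.le_succ N)
      _ ≤ (N + 1) * 2 ^ (N + 1) := Nat.le_mul_of_pos_left _ N.succ_pos
      _ ≤ _ := Nat.le_mul_of_pos_left _ hd⟩
  have h1 : 1 ≤ Nat.find hex := by
    rw [Nat.one_le_iff_ne_zero]
    intro h0
    have := Nat.find_spec hex
    rw [h0] at this
    omega
  refine ⟨Nat.find hex, h1, ?_, ?_⟩
  · have := Nat.find_min hex (Nat.sub_lt h1 one_pos)
    rw [Nat.sub_add_cancel h1] at this
    exact not_lt.mp this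
  · have hspec := Nat.find_spec hex
    set L := Nat.find hex
    have hd0 : (0 : ℝ) < d := by exact_mod_cast hd
    have hN0 : (0 : ℝ) < N := by exact_mod_cast (by omega : 0 < N)
    have hL : (1 : ℝ) ≤ L := by exact_mod_cast h1
    have hle : (N : ℝ) / d ≤ (L + 1) * 2 ^ (L + 1) := by
      rw [div_le_iff₀ hd0, mul_comm]
      exact_mod_cast hspec.le
    have hlog := Real.log_le_log (by positivity) hle
    rw [Real.log_mul (by positivity) (by positivity), Real.log_pow] at hlog
    have h2 := Real.log_le_sub_one_of_pos (by positivity : (0 : ℝ) < L + 1)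
    have h3 := Real.log_two_lt_d9
    push_cast at hlog
    nlinarith

theorem mainTheorem8 :
    ∃ c : ℝ, 0 < c ∧
      ∀ (X : Type u) [MeasurableSpace X] (U : Set (ProbabilityMeasure X)) (T : ℕ) (_ : 1 ≤ T)
        (ε : ℝ) (_ : 0 < ε) (d : ℕ) (_ : 1 ≤ d)
        (_ : ((3 * d : ℕ) : ℕ∞) ≤ fragmentationNumber U ε),
        ∃ F : Set (X → Bool), F.Nonempty ∧ (∀ f ∈ F, Measurable f) ∧ vcDim F ≤ d ∧
          ∀ alg : OnlineAlgorithm.{u, v} X, ∃ adv : ObliviousAdversary U T,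
            Integrable (realizedRegret alg F adv) (interactionLaw alg adv) ∧
              c * lowerRate ε d T (fragmentationNumber U ε) ≤ regret alg F adv := by
  -- A factor `1 / 32` comes from the phases, and `1 / 2` from `√3 ≤ 2` when `3 * L` replaces the
  -- logarithm.
  refine ⟨1 / 64, by norm_num, fun X _ U T hT ε hε d hd h => ?_⟩
  have hd0 : (1 : ℝ) ≤ d := by exact_mod_cast hd
  have hT0 : (1 : ℝ) ≤ T := by exact_mod_cast hT
  generalize hN : fragmentationNumber U ε = N at h ⊢
  induction N using ENat.recTopCoe with
  | top =>
    -- With unlimited fragments, depth `T` already makes the square root at least `ε * T`.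
    obtain ⟨F, hne, hm, hvc, hF⟩ := exists_class_regret_ge hε hd hT
      (hN.symm ▸ le_top : ((d * (T * 2 ^ T) : ℕ) : ℕ∞) ≤ fragmentationNumber U ε)
    refine ⟨F, hne, hm, hvc, fun alg => ?_⟩
    obtain ⟨adv, hint, hadv⟩ := hF T alg
    refine ⟨adv, hint, le_trans ?_ hadv⟩
    have hε1 : ε ≤ 1 := le_one_of_fragmentationNumber_pos
      (hN.symm ▸ ENat.top_pos : 0 < fragmentationNumber U ε)
    have h1 : ε * T ≤ Real.sqrt (ε * (d * T : ℕ) * T) := by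
      refine Real.le_sqrt_of_sq_le ?_
      push_cast
      have h2 : ε * ε ≤ d * ε := by nlinarith
      nlinarith [mul_le_mul_of_nonneg_right h2 (mul_self_nonneg (T : ℝ))]
    rw [min_eq_right h1]
    change 1 / 64 * (ε * T) ≤ _
    have : 0 ≤ ε * T := by positivity
    linarith
  | coe N =>
    obtain ⟨L, hL, hLN, hlog⟩ := exists_depth hd (by exact_mod_cast h : 3 * d ≤ N)
    obtain ⟨F, hne, hm, hvc, hF⟩ := exists_class_regret_ge hε hd hL
      (by rw [hN]; exact_mod_cast hLN : ((d * (L * 2 ^ L) : ℕ) : ℕ∞) ≤ fragmentationNumber U ε)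
    refine ⟨F, hne, hm, hvc, fun alg => ?_⟩
    obtain ⟨adv, hint, hadv⟩ := hF T alg
    refine ⟨adv, hint, le_trans ?_ hadv⟩
    have h1 : Real.sqrt (ε * d * T * Real.log ((N : ℝ) / d)) ≤
        2 * Real.sqrt (ε * (d * L : ℕ) * T) := by
      refine Real.sqrt_le_iff.mpr ⟨by positivity, ?_⟩
      rw [mul_pow, Real.sq_sqrt (by positivity)]
      push_cast
      have h2 : 0 ≤ ε * d * T := by positivity
      have h3 : 0 ≤ ε * d * T * L := by positivity
      linarith [mul_le_mul_of_nonneg_left hlog h2]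
    have h4 : 0 ≤ ε * T := by positivity
    change 1 / 64 * min (Real.sqrt (ε * d * T * Real.log ((N : ℝ) / d))) (ε * T) ≤ _
    rcases min_choice (Real.sqrt (ε * (d * L : ℕ) * T)) (ε * T) with h5 | h5 <;> rw [h5]
    · have := min_le_left (Real.sqrt (ε * d * T * Real.log ((N : ℝ) / d))) (ε * T)
      linarith
    · have := min_le_right (Real.sqrt (ε * d * T * Real.log ((N : ℝ) / d))) (ε * T)
      linarith
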